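/- Let $K$ be a compact connected Lie group of dimension $n$ with Lie algebra $\mathfrak K$, let $(\cdot,\cdot)$ be an $\mathrm{Ad}$-invariant inner product on $\mathfrak K$ and $X_1,\dots,X_n$ an orthonormal basis of $\mathfrak K$. Identify $T^*K\cong K\times\mathfrak K^*\cong K\times\mathfrak K$ by left translation and the inner product. Let $w^i$ be the left-invariant 1-forms dual to the $X_i$, $(y^1,\dots,y^n)$ the coordinates on $\mathfrak K$ in the basis $X_i$, $\theta=\sum_i y^iw^i$, $\omega=-d\theta$, and $\epsilon=\omega^n/n!$ (also regarded as the Liouville measure). Let $K_{\mathbb C}$ be the complexification of $K$, i.e. a complex Lie group with a smooth homomorphism $K\to K_{\mathbb C}$ that makes $\mathrm{Lie}(K_{\mathbb C})$ the complexification of $\mathfrak K$ and for which $(x,Y)\mapsto xe^{iY}$ is a diffeomorphism $K\times\mathfrak K\to K_{\mathbb C}$. For $s>0$ let $\psi_s:T^*K\to K_{\mathbb C}$, $\psi_s(x,Y)=xe^{isY}$, let $\tilde\eta_s^j$ be the pull-back by $\psi_s$ of the left-invariant holomorphic 1-form on $K_{\mathbb C}$ that takes the value $\delta^j_k$ on the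 left-invariant extension of $X_k$, and let $\Omega_s=\tilde\eta_s^1\wedge\dots\wedge\tilde\eta_s^n$. Put $b=(2i)^n(-1)^{n(n-1)/2}$ and let $|\Omega_s|\ge 0$ be the function with $\overline{\Omega}_s\wedge\Omega_s=|\Omega_s|^2\,b\,\epsilon$; it is everywhere positive. Let $\mathcal H_s$ be the Hilbert space of (classes of) sections $\sigma=f\sqrt{\Omega_s}$, $f:T^*K\to\mathbb C$, with $\int_{T^*K}|f|^2|\Omega_s|\,\epsilon<\infty$ and inner product $\langle f\sqrt{\Omega_s},g\sqrt{\Omega_s}\rangle=\int_{T^*K}\bar f g\,|\Omega_s|\,\epsilon$. The map $$T_s:L^2(T^*K,\epsilon)\to\mathcal H_s,\qquad f\mapsto \frac{f}{\sqrt{|\Omega_s|}}\sqrt{\Omega_s},$$ is a bijection preserving inner products. The maps $T_s$, $s>0$, trivialize the Hilbert bundle $\mathcal H\to(0,\infty)$ with fibres $\mathcal H_s$: a section $\sigma$ is smooth if $s\mapsto T_s^{-1}\sigma_s$ is a smooth $L^2(T^*K,\epsilon)$-valued function, and the prequantum connection $\delta^{\rm prQ}$ is the image of the trivial connection, $$(\delta^{\rm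 prQ}_{\partial/\partial s}\sigma)_s=T_s\Big(\frac{d}{ds}\,T_s^{-1}\sigma_s\Big).$$ For $s,s'>0$ the prequantum BKS pairing of $\tau=g\sqrt{\Omega_s}\in\mathcal H_s$ and $\sigma=f\sqrt{\Omega_{s'}}\in\mathcal H_{s'}$ is the (absolutely convergent) integral $$\langle\tau,\sigma\rangle^{\rm BKS}=\int_{T^*K}\bar g\,f\,\sqrt{\frac{\overline{\Omega}_s\wedge\Omega_{s'}}{b\,\epsilon}}\;\epsilon ,$$ and it induces a connection $\delta$ on $\mathcal H$ by $$\langle\tau,(\delta_{\partial/\partial s}\sigma)_s\rangle=\frac{\partial}{\partial s'}\Big|_{s'=s}\langle\tau,\sigma_{s'}\rangle^{\rm BKS}\qquad\text{for all }\tau\in\mathcal H_s .\qquad(*)$$ **Theorem.** The connections $\delta$ and $\delta^{\rm prQ}$ are equal: for every smooth section $\sigma$ of $\mathcal H$, every $s>0$ and every $v\in\mathcal H_s$, one has that for all $\tau\in\mathcal H_s$ the derivative $\frac{\partial}{\partial s'}\big|_{s'=s}\langle\tau,\sigma_{s'}\rangle^{\rm BKS}$ exists and equals $\langle\tau,v\rangle$,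 if and only if $v=(\delta^{\rm prQ}_{\partial/\partial s}\sigma)_s$. In particular $(*)$ does define a connection $\delta$, and it is $\delta^{\rm prQ}$. -/

import Mathlib

open scoped Manifold ContDiff
open MeasureTheory

noncomputable section

namespace PrequantumBKS

section General

variable {V : Type*} [NormedAddCommGroup V] [NormedSpace ℝ V]
  {M : Type*} [TopologicalSpace M] {H : Type*} [TopologicalSpace H] [ChartedSpace H M]

/-- The exterior derivative at `p` of a 1-form `θ` on a (boundaryless) manifold: the exterior
derivative of the expression of `θ` in the preferred chart at `p`. In Mathlib the tangent space at
`p` is identified with the model space through exactly this chart. -/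
def extDerivOneForm (I : ModelWithCorners ℝ V H) (θ : ∀ p : M, TangentSpace I p →L[ℝ] ℝ)
    (p : M) (u v : TangentSpace I p) : ℝ :=
  extDeriv (fun z : V => ContinuousAlternatingMap.ofSubsingleton ℝ V ℝ (0 : Fin 1)
      ((θ ((extChartAt I p).symm z)).comp (mfderiv 𝓘(ℝ, V) I (extChartAt I p).symm z)))
    (extChartAt I p p) ![u, v]

/-- `μ` is the measure `A ↦ ∫_A |α|` of the top-degree form `α` on a (boundaryless) manifold
modelled on `V`: over every chart, `μ` has density `|α (∂₁, …, ∂ₘ)|` with respect to Lebesgue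
measure, where `e₁, …, eₘ` is a basis of `V`, the `∂ᵢ` are the corresponding coordinate vector
fields, and Lebesgue measure is normalized by `e₁, …, eₘ`. -/
def IsMeasureOfTopForm {m : ℕ} [FiniteDimensional ℝ V] [MeasurableSpace V] [BorelSpace V]
    [MeasurableSpace M] (I : ModelWithCorners ℝ V H) (e : Module.Basis (Fin m) ℝ V)
    (α : ∀ p : M, (Fin m → TangentSpace I p) → ℝ) (μ : Measure M) : Prop :=
  ∀ (p₀ : M) (A : Set M), MeasurableSet A → A ⊆ (chartAt H p₀).source →
    μ A = ∫⁻ z in extChartAt I p₀ '' A,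
      ENNReal.ofReal |α ((extChartAt I p₀).symm z)
        (fun i => mfderiv 𝓘(ℝ, V) I (extChartAt I p₀).symm z (e i))| ∂e.addHaar

/-- The value of `α₁ ∧ ⋯ ∧ αₘ` on `(v₁, …, vₘ)`, for complex-valued 1-forms `αₖ`. -/
def wedgeOneForms {m : ℕ} {W : Type*} (α : Fin m → W → ℂ) (v : Fin m → W) : ℂ :=
  Matrix.det (Matrix.of fun k l => α k (v l))

/-- The value of `βⁿ / n!` on `(v₁, …, v₂ₙ)`, for a 2-form `β`. -/
def wedgePowTwoForm {n : ℕ} {W : Type*} (β : W → W → ℝ) (v : Fin (n + n) → W) : ℝ :=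
  (1 / (2 ^ n * (n.factorial : ℝ))) * ∑ π : Equiv.Perm (Fin (n + n)),
    ((Equiv.Perm.sign π : ℤ) : ℝ) *
      ∏ i : Fin n, β (v (π ⟨2 * i, by omega⟩)) (v (π ⟨2 * i + 1, by omega⟩))

end General

section LieGroups

/-- `γ` is the one-parameter subgroup of the Lie group `G` with initial velocity `X ∈ T₁G`
(which is the model space `F`). -/
def IsOneParameterSubgroup {F : Type*} [NormedAddCommGroup F] [NormedSpace ℝ F]
    {G : Type*} [TopologicalSpace G] [ChartedSpace F G] [Group G] (γ : ℝ → G) (X : F) : Prop :=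
  (∀ s t, γ (s + t) = γ s * γ t) ∧
    HasMFDerivAt 𝓘(ℝ, ℝ) 𝓘(ℝ, F) γ 0 (ContinuousLinearMap.toSpanSingleton ℝ X : ℝ →L[ℝ] F)

/-- The exponential map `T₁G → G` of a Lie group: the value at time `1` of the one-parameter
subgroup with the given initial velocity. -/
def lieExp {F : Type*} [NormedAddCommGroup F] [NormedSpace ℝ F]
    {G : Type*} [TopologicalSpace G] [ChartedSpace F G] [Group G] (X : F) : G :=
  Classical.epsilon fun g : G => ∃ γ : ℝ → G, IsOneParameterSubgroup γ X ∧ γ 1 = g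

variable {E : Type*} [NormedAddCommGroup E] [NormedSpace ℝ E]
  {K : Type*} [TopologicalSpace K] [ChartedSpace E K] [Group K]
  {F : Type*} [NormedAddCommGroup F] [NormedSpace ℂ F]
  {G : Type*} [TopologicalSpace G] [ChartedSpace F G] [Group G]

/-- The adjoint action of `x ∈ K` on the Lie algebra `T₁K` (which is the model space `E`). -/
def Ad (x : K) : E →L[ℝ] E :=
  mfderiv 𝓘(ℝ, E) 𝓘(ℝ, E) (fun y : K => x * y * x⁻¹) 1

/-- Left translation `T_xK → T₁K` (the left-invariant Maurer–Cartan form). -/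
def leftTriv (x : K) : TangentSpace 𝓘(ℝ, E) x →L[ℝ] E :=
  mfderiv 𝓘(ℝ, E) 𝓘(ℝ, E) (fun y : K => x⁻¹ * y) x

/-- The differential at the identity `T₁K → T₁G` of a homomorphism `ι : K → G`. -/
def lieDiff (ι : K →* G) : E →L[ℝ] F :=
  mfderiv 𝓘(ℝ, E) 𝓘(ℝ, F) (fun y : K => ι y) 1

/-- The map `(u, v) ↦ dι u + i dι v` from `Lie(K) ⊗ ℂ = Lie(K) ⊕ i Lie(K)` to `Lie(G)`. -/
def complexifiedDiff (ι : K →* G) (uv : E × E) : F :=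
  lieDiff ι uv.1 + Complex.I • lieDiff ι uv.2

/-- The map `ψ_s (x, Y) = x e^{isY}` from `T^*K = K × Lie(K)` to `G`. -/
def psi (F : Type*) [NormedAddCommGroup F] [NormedSpace ℂ F] [ChartedSpace F G] (ι : K →* G) (s : ℝ) (p : K × E) : G :=
  ι p.1 * lieExp (((s : ℂ) * Complex.I) • (lieDiff ι p.2 : F))

/-- The complex Lie group `G`, together with `ι : K → G`, is the complexification of the compact
Lie group `K`: the homomorphism `ι` is smooth, the Lie algebra of `G` is the complexification
of that of `K`, and the polar decomposition `(x, Y) ↦ x e^{iY}` is a diffeomorphism from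
`K × Lie(K)` onto `G`. -/
structure IsComplexification (E F : Type*) [NormedAddCommGroup E] [NormedSpace ℝ E]
    [ChartedSpace E K] [NormedAddCommGroup F] [NormedSpace ℂ F] [ChartedSpace F G]
    (ι : K →* G) : Prop where
  contMDiff : ContMDiff 𝓘(ℝ, E) 𝓘(ℝ, F) ∞ ι
  bijective_complexifiedDiff : Function.Bijective (complexifiedDiff (E := E) (F := F) ι)
  polar : ∃ Φ : Diffeomorph (𝓘(ℝ, E).prod 𝓘(ℝ, E)) 𝓘(ℝ, F) (K × E) G ∞, ∀ p, Φ p = psi F ι 1 p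

end LieGroups

section PhaseSpace

/-! In this section `T^*K` is `K × E`, where `E = T₁K` is the Lie algebra of `K`, `X₁, …, Xₙ` is
an orthonormal basis of `E`, and `(y¹, …, yⁿ)` are the coordinates of `Y ∈ E` in this basis. -/

variable {E : Type*} [NormedAddCommGroup E] [NormedSpace ℝ E] [FiniteDimensional ℝ E]
  {K : Type*} [TopologicalSpace K] [ChartedSpace E K] [Group K]
  (F : Type*) [NormedAddCommGroup F] [NormedSpace ℂ F]
  {G : Type*} [TopologicalSpace G] [ChartedSpace F G] [Group G]
  {n : ℕ}

/-- The model with corners of `T^*K = K × Lie(K)`. -/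
abbrev modelT (E : Type*) [NormedAddCommGroup E] [NormedSpace ℝ E] :
    ModelWithCorners ℝ (E × E) (ModelProd E E) := 𝓘(ℝ, E).prod 𝓘(ℝ, E)

/-- The pull-back `wⁱ` to `T^*K` of the left-invariant 1-form on `K` dual to `Xᵢ`. -/
def wForm (X : Module.Basis (Fin n) ℝ E) (i : Fin n) (p : K × E) :
    TangentSpace (modelT E) p →L[ℝ] ℝ :=
  ((LinearMap.toContinuousLinearMap (X.coord i)).comp (leftTriv p.1)).comp
    (ContinuousLinearMap.fst ℝ E E)

/-- The canonical 1-form `θ = ∑ᵢ yⁱ wⁱ`. -/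
def thetaForm (X : Module.Basis (Fin n) ℝ E) (p : K × E) : TangentSpace (modelT E) p →L[ℝ] ℝ :=
  ∑ i, X.repr p.2 i • wForm X i p

/-- The symplectic form `ω = -dθ`. -/
def omegaForm (X : Module.Basis (Fin n) ℝ E) (p : K × E) (u v : TangentSpace (modelT E) p) : ℝ :=
  -extDerivOneForm (modelT E) (thetaForm (K := K) X) p u v

/-- The Liouville form `ε = ωⁿ / n!`. -/
def liouvilleForm (X : Module.Basis (Fin n) ℝ E) (p : K × E)
    (v : Fin (n + n) → TangentSpace (modelT E) p) : ℝ :=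
  wedgePowTwoForm (omegaForm X p) v

/-- `μ` is the Liouville measure on `T^*K`. -/
def IsLiouvilleMeasure [MeasurableSpace E] [BorelSpace E] [MeasurableSpace K]
    (X : Module.Basis (Fin n) ℝ E) (μ : Measure (K × E)) : Prop :=
  IsMeasureOfTopForm (modelT E) ((X.prod X).reindex finSumFinEquiv) (liouvilleForm X) μ

/-- The complex-linear functional `dι u + i dι v ↦ (j-th coordinate of u) + i (j-th coordinate
of v)` on `Lie(K_ℂ)`: the value at the identity of the left-invariant holomorphic
1-form on `K_ℂ` dual to `X_{j,ℂ}`. -/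
def complexCoord (ι : K →* G) (X : Module.Basis (Fin n) ℝ E) (j : Fin n) (ζ : F) : ℂ :=
  (X.repr (Function.invFun (complexifiedDiff (E := E) (F := F) ι) ζ).1 j : ℂ) +
    Complex.I * (X.repr (Function.invFun (complexifiedDiff (E := E) (F := F) ι) ζ).2 j : ℂ)

/-- The differential of `ψ_s` at `p`, followed by left translation to the identity of `K_ℂ`. -/
def psiDiff (ι : K →* G) (s : ℝ) (p : K × E) : TangentSpace (modelT E) p →L[ℝ] F :=
  mfderiv (modelT E) 𝓘(ℝ, F) (fun q : K × E => (psi F ι s p)⁻¹ * psi F ι s q) p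

/-- The left-invariant `J_s`-holomorphic 1-form `η̃_s^j = w̃^j - i J_s w̃^j` on `T^*K`. Since `J_s`
is transported from `K_ℂ` by `ψ_s` and the `w̃^j` are dual to the frame that `ψ_s` maps to the
left-invariant frame `(X_{j,ℂ}, J X_{j,ℂ})`, it is the pull-back by `ψ_s` of the left-invariant
holomorphic 1-form dual to `X_{j,ℂ}`. -/
def etaForm (ι : K →* G) (X : Module.Basis (Fin n) ℝ E) (s : ℝ) (j : Fin n) (p : K × E)
    (v : TangentSpace (modelT E) p) : ℂ :=
  complexCoord F ι X j (psiDiff F ι s p v)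

/-- The `2n`-form `Ω̄_s ∧ Ω_{s'}`, where `Ω_s = η̃_s¹ ∧ ⋯ ∧ η̃_sⁿ`. -/
def OmegaBarWedgeOmega (ι : K →* G) (X : Module.Basis (Fin n) ℝ E) (s s' : ℝ) (p : K × E)
    (v : Fin (n + n) → TangentSpace (modelT E) p) : ℂ :=
  wedgeOneForms (Fin.append (fun j w => (starRingEnd ℂ) (etaForm F ι X s j p w))
    (fun j w => etaForm F ι X s' j p w)) v

/-- The left-invariant frame `(X₁, …, Xₙ, ∂/∂y¹, …, ∂/∂yⁿ)` of `T^*K`. -/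
def leftFrame (X : Module.Basis (Fin n) ℝ E) (p : K × E) :
    Fin (n + n) → TangentSpace (modelT E) p :=
  Fin.append
    (fun i => ((mfderiv 𝓘(ℝ, E) 𝓘(ℝ, E) (fun y : K => p.1 * y) 1 (X i), (0 : E)) : E × E))
    (fun i => (((0 : E), X i) : E × E))

/-- The constant `b = (2i)ⁿ (-1)^{n(n-1)/2}`. -/
def bConst (n : ℕ) : ℂ := (2 * Complex.I) ^ n * (-1) ^ (n * (n - 1) / 2)

/-- The function `(Ω̄_s ∧ Ω_{s'}) / (b ε)` on `T^*K`. The quotient of two top-degree forms is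
computed on a frame. -/
def bksRatio (ι : K →* G) (X : Module.Basis (Fin n) ℝ E) (s s' : ℝ) (p : K × E) : ℂ :=
  OmegaBarWedgeOmega F ι X s s' p (leftFrame X p) /
    (bConst n * (liouvilleForm X p (leftFrame X p) : ℂ))

/-- The norm `|Ω_s|`, the non-negative function with `Ω̄_s ∧ Ω_s = |Ω_s|² b ε`. -/
def normOmega (ι : K →* G) (X : Module.Basis (Fin n) ℝ E) (s : ℝ) (p : K × E) : ℝ :=
  Real.sqrt (bksRatio F ι X s s p).re

variable [MeasurableSpace E] [MeasurableSpace K]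

/-- The prequantum Hilbert space `H_s`, consisting of the sections `f √Ω_s` with
`∫ |f|² |Ω_s| ε < ∞` (up to equality almost everywhere); such a section is represented by its
coefficient `f`. -/
abbrev PrQ (ι : K →* G) (X : Module.Basis (Fin n) ℝ E) (μ : Measure (K × E)) (s : ℝ) : Type _ :=
  Lp ℂ 2 (μ.withDensity fun p => ENNReal.ofReal (normOmega F ι X s p))

open Classical in
/-- The global trivialization `(f, s) ↦ (f / √|Ω_s|) √Ω_s` from `L²(T^*K, ε)` to `H_s`. (The
condition in the definition always holds for `s > 0`.) -/
def triv (ι : K →* G) (X : Module.Basis (Fin n) ℝ E) (μ : Measure (K × E)) (s : ℝ)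
    (f : Lp ℂ 2 μ) : PrQ F ι X μ s :=
  if h : MemLp (fun p => f p / (Real.sqrt (normOmega F ι X s p) : ℂ)) 2
      (μ.withDensity fun p => ENNReal.ofReal (normOmega F ι X s p))
  then h.toLp else 0

/-- The expression in the global trivialization of a section of the prequantum bundle over the
half-line `s > 0`. (A section is a family indexed by all real `s` here, but only its values for
`s > 0` are used.) -/
def inTriv (ι : K →* G) (X : Module.Basis (Fin n) ℝ E) (μ : Measure (K × E))
    (σ : ∀ s : ℝ, PrQ F ι X μ s) (s : ℝ) : Lp ℂ 2 μ :=
  Function.invFun (triv F ι X μ s) (σ s)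

/-- Smooth sections of the prequantum bundle, whose smooth structure is the one given by the global
trivialization. -/
def IsSmoothSection (ι : K →* G) (X : Module.Basis (Fin n) ℝ E) (μ : Measure (K × E))
    (σ : ∀ s : ℝ, PrQ F ι X μ s) : Prop :=
  ContDiffOn ℝ ∞ (inTriv F ι X μ σ) (Set.Ioi 0)

/-- The covariant derivative along `∂/∂s` for the prequantum connection, which is the image of the
trivial connection under the global trivialization. -/
def prqConnection (ι : K →* G) (X : Module.Basis (Fin n) ℝ E) (μ : Measure (K × E))
    (σ : ∀ s : ℝ, PrQ F ι X μ s) (s : ℝ) : PrQ F ι X μ s :=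
  triv F ι X μ s (deriv (inTriv F ι X μ σ) s)

/-- The integrand of the prequantum BKS pairing. -/
def bksIntegrand (ι : K →* G) (X : Module.Basis (Fin n) ℝ E) (μ : Measure (K × E)) {s s' : ℝ}
    (τ : PrQ F ι X μ s) (σ : PrQ F ι X μ s') (p : K × E) : ℂ :=
  (starRingEnd ℂ) (τ p) * σ p * (bksRatio F ι X s s' p) ^ (1 / 2 : ℂ)

/-- The prequantum BKS pairing between `H_s` and `H_{s'}`. -/
def bksPairing (ι : K →* G) (X : Module.Basis (Fin n) ℝ E) (μ : Measure (K × E)) {s s' : ℝ}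
    (τ : PrQ F ι X μ s) (σ : PrQ F ι X μ s') : ℂ :=
  ∫ p, bksIntegrand F ι X μ τ σ p ∂μ

/-- `v ∈ H_s` is the covariant derivative along `∂/∂s` at `s` of the section `σ` for the connection
induced by the infinitesimal prequantum BKS pairing:
`⟨τ, v⟩ = ∂/∂s' |_{s' = s} ⟨τ, σ_{s'}⟩^{BKS}` for all `τ ∈ H_s`. -/
def IsBKSCovariantDerivative (ι : K →* G) (X : Module.Basis (Fin n) ℝ E) (μ : Measure (K × E))
    (σ : ∀ s : ℝ, PrQ F ι X μ s) (s : ℝ) (v : PrQ F ι X μ s) : Prop :=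
  ∀ τ : PrQ F ι X μ s, HasDerivAt (fun s' : ℝ => bksPairing F ι X μ τ (σ s')) (inner ℂ τ v) s


end PhaseSpace

end PrequantumBKS

end

open PrequantumBKS

/-! Evaluated on the left-invariant frame, the forms `η̃_s` have the block matrix `(P_s | Q_s)`,
where `P_s` is the matrix of `Ad(e^{-isY})` and `Q_s` that of the left logarithmic derivative of `Y
↦ e^{isY}`. With `H = i ad_Y` they solve `P' = -HP`, `P_0 = 1` and `Q' = -HQ + i`, `Q_0 = 0`.
Invariance of the inner product makes `H` Hermitian with purely imaginary entries. So `H` has real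
eigenvalues `l` of sum zero, and conjugating `P_s` and `Q_s` amounts to replacing `s` by `-s`. The
block determinant factors over the eigenvalues, and after division by `b ε` it becomes `D(s + s') =
∏ ψ_l(s + s') / 2` with `ψ_l(r) = ∫₀ʳ e^{-lu} du` (`exists_bksRatio_eq_prod`). In particular it is
positive and depends on `s + s'` only.

In the global trivialization the BKS pairing of `H_s` and `H_t` is therefore the `L²` pairing with
kernel `R = √D(s+t) / (D(2s) D(2t))^{1/4}`, which equals `1` at `t = s`. The essential point is that
`R - 1` vanishes to second order there, uniformly over the non-compact phase space: `1 ≤ R ≤ (1 +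
(t-s)²/(4st))ⁿ` (`one_le_bksKernel_and_le`), which comes from the monotonicity of `sinh x / x`.
Multiplication by `R` thus moves a differentiable `L²` curve by `o(t - s)` in norm
(`HasDerivAt.of_norm_sub_le_mul`), so the derivative of the pairing at `t = s` only sees the
derivative of the curve. Nondegeneracy of the inner product gives uniqueness of `v`. -/

/-! ### Complex manifolds and Lie groups viewed as real ones. -/

section RestrictScalars

theorem ContMDiffAt.restrictScalars_complex {E F : Type*} [NormedAddCommGroup E] [NormedSpace ℂ E]
    [NormedAddCommGroup F] [NormedSpace ℂ F] {H H' : Type*} [TopologicalSpace H] [TopologicalSpace H']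
    {I : ModelWithCorners ℂ E H} {I' : ModelWithCorners ℂ F H'}
    {J : ModelWithCorners ℝ E H} {J' : ModelWithCorners ℝ F H'}
    (hI : I.toPartialEquiv = J.toPartialEquiv) (hI' : I'.toPartialEquiv = J'.toPartialEquiv)
    {M N : Type*} [TopologicalSpace M] [ChartedSpace H M] [TopologicalSpace N] [ChartedSpace H' N]
    {n : ℕ∞ω} {f : M → N} {x : M} (h : ContMDiffAt I I' n f x) : ContMDiffAt J J' n f x := by
  rw [contMDiffAt_iff] at h ⊢
  refine ⟨h.1, ?_⟩
  have h2 := h.2.restrict_scalars ℝ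
  have e : ∀ x : M, extChartAt I x = extChartAt J x := fun x => by
    simp only [extChartAt, OpenPartialHomeomorph.extend, hI]
  have e' : ∀ x : N, extChartAt I' x = extChartAt J' x := fun x => by
    simp only [extChartAt, OpenPartialHomeomorph.extend, hI']
  have r : Set.range I = Set.range J := by
    rw [← I.target_eq, ← J.target_eq, hI]
  rwa [e, e', r] at h2

theorem LieGroup.restrictScalars_complex {F : Type*} [NormedAddCommGroup F] [NormedSpace ℂ F]
    {G : Type*} [TopologicalSpace G] [ChartedSpace F G] [Group G] {n : ℕ∞ω} [LieGroup 𝓘(ℂ, F) n G] :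
    LieGroup 𝓘(ℝ, F) n G where
  toIsManifold := by
    refine isManifold_of_contDiffOn 𝓘(ℝ, F) n G fun e e' he he' => ?_
    have := (contDiffGroupoid n 𝓘(ℂ, F)).compatible he he'
    rw [contDiffGroupoid, mem_groupoid_of_pregroupoid] at this
    exact this.1.restrict_scalars ℝ
  contMDiff_mul := fun p =>
    (contMDiff_mul 𝓘(ℂ, F) n p).restrictScalars_complex rfl rfl
  contMDiff_inv := fun p =>
    (_root_.contMDiff_inv 𝓘(ℂ, F) n p).restrictScalars_complex rfl rfl

theorem HasMFDerivAt.restrictScalars_complex {E F : Type*} [NormedAddCommGroup E] [NormedSpace ℂ E]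
    [NormedAddCommGroup F] [NormedSpace ℂ F]
    {M N : Type*} [TopologicalSpace M] [ChartedSpace E M] [TopologicalSpace N] [ChartedSpace F N]
    {f : M → N} {x : M} {f' : E →L[ℂ] F} (h : HasMFDerivAt 𝓘(ℂ, E) 𝓘(ℂ, F) f x f') :
    HasMFDerivAt 𝓘(ℝ, E) 𝓘(ℝ, F) f x (f'.restrictScalars ℝ) :=
  ⟨h.1, HasFDerivWithinAt.restrictScalars ℝ h.2⟩

end RestrictScalars

/-! ### Logarithmic derivatives, the adjoint action and the product rule at the identity. -/

section
variable {𝕜 : Type*} [NontriviallyNormedField 𝕜]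
  {F : Type*} [NormedAddCommGroup F] [NormedSpace 𝕜 F]
  {G : Type*} [TopologicalSpace G] [ChartedSpace F G]

/-- Maps translated so as to take the value `1` at the point of differentiation always land in the
same tangent space. This removes the coordinate changes that appear when their derivatives are
compared. -/
theorem tangentBundleCore_coordChange_of_eq [IsManifold 𝓘(𝕜, F) 1 G] {a b c : G} (h : a = b)
    (hc : c ∈ (chartAt F b).source) :
   (tangentBundleCore 𝓘(𝕜, F) G).coordChange (achart F a) (achart F b) c = ContinuousLinearMap.id 𝕜 F := by
  subst h
  ext v
  exact (tangentBundleCore 𝓘(𝕜, F) G).coordChange_self (achart F a) c hc v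

theorem mfderiv_eq_id_of_eq_id {f : G → G} (hf : f = id) (x : G) :
    (mfderiv 𝓘(𝕜, F) 𝓘(𝕜, F) f x : F →L[𝕜] F) = ContinuousLinearMap.id 𝕜 F := by
  subst hf
  exact mfderiv_id

variable [Group G]

variable (𝕜 F) in
/-- The left logarithmic derivative of a map into a Lie group. -/
noncomputable def leftLogDeriv {V : Type*} [NormedAddCommGroup V] [NormedSpace 𝕜 V] (h : V → G) (x : V) :
    V →L[𝕜] F :=
  mfderiv 𝓘(𝕜, V) 𝓘(𝕜, F) (fun y => (h x)⁻¹ * h y) x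

/-- The two-variable map `(x, y) ↦ h(x)⁻¹ h(y)` is smooth and is `1` on the diagonal, so its partial
derivative in `y` along the diagonal needs no change of tangent coordinates. -/
theorem contDiffAt_leftLogDeriv [LieGroup 𝓘(𝕜, F) ∞ G]
    {V : Type*} [NormedAddCommGroup V] [NormedSpace 𝕜 V] {h : V → G} {x : V}
    (hh : ContMDiffAt 𝓘(𝕜, V) 𝓘(𝕜, F) ∞ h x) : ContDiffAt 𝕜 1 (leftLogDeriv 𝕜 F h) x := by
  have : IsManifold 𝓘(𝕜, F) 1 G := IsManifold.of_le (n := ∞) (by simp)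
  have h1 : ContMDiffAt (𝓘(𝕜, V).prod 𝓘(𝕜, V)) 𝓘(𝕜, F) ∞
      (Function.uncurry fun x y : V => (h x)⁻¹ * h y) (x, id x) :=
    ((hh.comp (x, x) contMDiffAt_fst).inv).mul (hh.comp (x, x) contMDiffAt_snd)
  have h2 := h1.mfderiv (fun x y : V => (h x)⁻¹ * h y) id (m := 1) contMDiffAt_id
    (by norm_num; exact right_eq_inf.mp rfl)
  rw [← contMDiffAt_iff_contDiffAt]
  refine h2.congr_of_eventuallyEq (Filter.Eventually.of_forall fun y => ?_)
  have h3 := inTangentCoordinates_eq (I := 𝓘(𝕜, V)) (I' := 𝓘(𝕜, F)) id (fun x : V => (h x)⁻¹ * h x)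
     (fun x => mfderiv 𝓘(𝕜, V) 𝓘(𝕜, F) (fun y => (h x)⁻¹ * h y) x) (x₀ := x) (x := y)
     (by simp [chartAt_self_eq]) (by simp)
  rw [tangentBundleCore_coordChange_of_eq (by simp) (by simp),
    tangentBundleCore_coordChange_model_space] at h3
  exact h3.symm

variable (𝕜 F) in
/-- The adjoint action of a Lie group on its tangent space at the identity. -/
noncomputable def adjointAction (g : G) : F →L[𝕜] F :=
  mfderiv 𝓘(𝕜, F) 𝓘(𝕜, F) (fun y : G => g * y * g⁻¹) 1

theorem adjointAction_one : adjointAction 𝕜 F (1 : G) = ContinuousLinearMap.id 𝕜 F :=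
  mfderiv_eq_id_of_eq_id (by ext y; simp) 1

variable [LieGroup 𝓘(𝕜, F) ∞ G]

theorem mdifferentiableAt_conj (g h : G) : MDifferentiableAt 𝓘(𝕜, F) 𝓘(𝕜, F) (fun y : G => g * y * g⁻¹) h :=
  ((contMDiffAt_const.mul contMDiffAt_id).mul contMDiffAt_const :
   ContMDiffAt 𝓘(𝕜, F) 𝓘(𝕜, F) ∞ (fun y : G => g * y * g⁻¹) h).mdifferentiableAt (by simp)

theorem hasMFDerivAt_conj (g h : G) (hh : h = 1) :
    HasMFDerivAt 𝓘(𝕜, F) 𝓘(𝕜, F) (fun y : G => g * y * g⁻¹) h (adjointAction 𝕜 F g : F →L[𝕜] F) := by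
  subst hh
  exact (mdifferentiableAt_conj g 1).hasMFDerivAt

theorem adjointAction_mul (g h : G) :
    adjointAction 𝕜 F (g * h) = (adjointAction 𝕜 F g).comp (adjointAction 𝕜 F h) := by
  have h1 := (hasMFDerivAt_conj (𝕜 := 𝕜) (F := F) g (h * 1 * h⁻¹) (by simp)).comp 1
    (hasMFDerivAt_conj (𝕜 := 𝕜) (F := F) h 1 rfl)
  have h2 := hasMFDerivAt_conj (𝕜 := 𝕜) (F := F) (g * h) 1 rfl
  have e : (fun y : G => g * y * g⁻¹) ∘ (fun y : G => h * y * h⁻¹) = fun y => (g * h) * y * (g * h)⁻¹ := by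
    ext y; simp [mul_assoc]
  rw [e] at h1
  exact hasMFDerivAt_unique h2 h1

theorem contMDiffAt_adjointAction :
    ContMDiffAt 𝓘(𝕜, F) 𝓘(𝕜, F →L[𝕜] F) 1 (adjointAction 𝕜 F : G → (F →L[𝕜] F)) 1 := by
  have : IsManifold 𝓘(𝕜, F) 1 G := IsManifold.of_le (n := ∞) (by simp)
  have h1 : ContMDiffAt (𝓘(𝕜, F).prod 𝓘(𝕜, F)) 𝓘(𝕜, F) ∞
      (Function.uncurry fun x y : G => x * y * x⁻¹) ((1 : G), (1 : G)) :=
    (contMDiffAt_fst.mul contMDiffAt_snd).mul contMDiffAt_fst.inv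
  have h2 := h1.mfderiv (fun x y : G => x * y * x⁻¹) (fun _ => 1) (m := 1) contMDiffAt_const
    (by norm_num; exact right_eq_inf.mp rfl)
  refine h2.congr_of_eventuallyEq (Filter.Eventually.of_forall fun y => ?_)
  have h3 := inTangentCoordinates_eq (I := 𝓘(𝕜, F)) (I' := 𝓘(𝕜, F)) (fun _ : G => (1 : G)) (fun x : G => x * 1 * x⁻¹)
     (fun x => mfderiv 𝓘(𝕜, F) 𝓘(𝕜, F) (fun y => x * y * x⁻¹) 1) (x₀ := (1 : G)) (x := y)
     (by simp) (by simp)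
  rw [tangentBundleCore_coordChange_of_eq (by simp) (by simp),
    tangentBundleCore_coordChange_of_eq rfl (by simp)] at h3
  exact h3.symm

variable (𝕜 F G) in
/-- The derivative at the identity of the adjoint action. -/
noncomputable def adjointDeriv : F →L[𝕜] (F →L[𝕜] F) :=
  mfderiv 𝓘(𝕜, F) 𝓘(𝕜, F →L[𝕜] F) (adjointAction 𝕜 F : G → (F →L[𝕜] F)) 1

theorem hasMFDerivAt_adjointAction {g : G} (hg : g = 1) :
    HasMFDerivAt 𝓘(𝕜, F) 𝓘(𝕜, F →L[𝕜] F) (adjointAction 𝕜 F : G → (F →L[𝕜] F)) g (adjointDeriv 𝕜 F G) := by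
  subst hg
  exact (contMDiffAt_adjointAction.mdifferentiableAt one_ne_zero).hasMFDerivAt

/-- At the identity both partial maps `z ↦ z * 1` and `z ↦ 1 * z` are the identity. The equations
are hypotheses because in applications the factors are only provably equal to `1`. -/
theorem hasMFDerivAt_mul_of_eq_one {p : G × G} (h1 : p.1 = 1) (h2 : p.2 = 1) :
    HasMFDerivAt (𝓘(𝕜, F).prod 𝓘(𝕜, F)) 𝓘(𝕜, F) (fun p : G × G => p.1 * p.2) p
      (ContinuousLinearMap.fst 𝕜 F F + ContinuousLinearMap.snd 𝕜 F F) := by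
  obtain ⟨a, b⟩ := p
  dsimp only at h1 h2
  subst h1 h2
  have hd : MDifferentiableAt (𝓘(𝕜, F).prod 𝓘(𝕜, F)) 𝓘(𝕜, F) (fun p : G × G => p.1 * p.2) (1, 1) :=
    (contMDiff_mul 𝓘(𝕜, F) ∞ (1, 1)).mdifferentiableAt (by simp)
  refine hd.hasMFDerivAt.congr_mfderiv ?_
  ext v
  have h3 := mfderiv_prod_eq_add_apply (v := v) hd
  refine h3.trans ?_
  have a1 := DFunLike.congr_fun (mfderiv_eq_id_of_eq_id (𝕜 := 𝕜) (F := F)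
    (f := fun z : G => z * 1) (by ext; simp) 1) v.1
  have a2 := DFunLike.congr_fun (mfderiv_eq_id_of_eq_id (𝕜 := 𝕜) (F := F)
    (f := fun z : G => 1 * z) (by ext; simp) 1) v.2
  exact congrArg₂ (· + ·) a1 a2

theorem HasMFDerivAt.mul_of_eq_one {V M H : Type*} [NormedAddCommGroup V] [NormedSpace 𝕜 V]
    [TopologicalSpace H] [TopologicalSpace M] {J : ModelWithCorners 𝕜 V H} [ChartedSpace H M]
    {f g : M → G} {x : M} {f' g' : V →L[𝕜] F} (hf : HasMFDerivAt J 𝓘(𝕜, F) f x f')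
    (hg : HasMFDerivAt J 𝓘(𝕜, F) g x g') (hfx : f x = 1) (hgx : g x = 1) :
    HasMFDerivAt J 𝓘(𝕜, F) (fun y => f y * g y) x (f' + g' : V →L[𝕜] F) :=
  (hasMFDerivAt_mul_of_eq_one (𝕜 := 𝕜) (F := F) (p := (f x, g x)) hfx hgx).comp x (hf.prodMk hg)

end

/-! ### One-parameter subgroups and the exponential map. -/

section OneParameter
variable {F : Type*} [NormedAddCommGroup F] [NormedSpace ℝ F]
  {G : Type*} [TopologicalSpace G] [ChartedSpace F G] [Group G] [LieGroup 𝓘(ℝ, F) ∞ G]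

omit [LieGroup 𝓘(ℝ, F) ∞ G] in
theorem mulInvariantVectorField_one (ζ : F) :
    (mulInvariantVectorField (I := 𝓘(ℝ, F)) (G := G) ζ 1 : F) = ζ :=
  DFunLike.congr_fun (mfderiv_eq_id_of_eq_id (𝕜 := ℝ) (F := F)
    (f := fun z : G => 1 * z) (by ext; simp) 1) ζ

theorem mdifferentiableAt_mul_left_const (x g : G) :
    MDifferentiableAt 𝓘(ℝ, F) 𝓘(ℝ, F) (fun y : G => x * y) g :=
  ((contMDiff_mul_left (I := 𝓘(ℝ, F)) (n := ∞)) g).mdifferentiableAt (by simp)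

theorem mfderiv_mul_left_mulInvariantVectorField (ζ : F) (x g : G) :
    mfderiv 𝓘(ℝ, F) 𝓘(ℝ, F) (fun y : G => x * y) g (mulInvariantVectorField (I := 𝓘(ℝ, F)) ζ g)
      = mulInvariantVectorField (I := 𝓘(ℝ, F)) (G := G) ζ (x * g) := by
  have h1 := (mdifferentiableAt_mul_left_const (F := F) x (g * 1)).hasMFDerivAt.comp 1
    (mdifferentiableAt_mul_left_const (F := F) g 1).hasMFDerivAt
  have h2 := (mdifferentiableAt_mul_left_const (F := F) (x * g) 1).hasMFDerivAt
  have e : (fun y : G => x * y) ∘ (fun y => g * y) = fun y => (x * g) * y := by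
    ext y; simp [mul_assoc]
  rw [e] at h1
  have := DFunLike.congr_fun (hasMFDerivAt_unique h2 h1) ζ
  have e2 : g * 1 = g := mul_one g
  refine Eq.trans ?_ this.symm
  change _ = mfderiv 𝓘(ℝ, F) 𝓘(ℝ, F) (fun y : G => x * y) (g * 1)
    (mulInvariantVectorField (I := 𝓘(ℝ, F)) ζ g : F)
  rw [e2]

theorem IsMIntegralCurveOn.mul_left {γ : ℝ → G} {ζ : F} {s : Set ℝ}
    (h : IsMIntegralCurveOn γ (mulInvariantVectorField (I := 𝓘(ℝ, F)) (G := G) ζ) s) (x : G) :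
    IsMIntegralCurveOn (fun t => x * γ t) (mulInvariantVectorField (I := 𝓘(ℝ, F)) (G := G) ζ) s := by
  intro t ht
  have h1 := (mdifferentiableAt_mul_left_const (F := F) x (γ t)).hasMFDerivAt.comp_hasMFDerivWithinAt t (h t ht)
  refine h1.congr_mfderiv ?_
  refine ContinuousLinearMap.ext fun (r : ℝ) => ?_
  have := mfderiv_mul_left_mulInvariantVectorField ζ x (γ t)
  exact (ContinuousLinearMap.map_smul _ _ _).trans (congrArg (fun w : F => r • w) this)

theorem contMDiff_mulInvariantVectorField_one (ζ : F) :
    ContMDiff 𝓘(ℝ, F) 𝓘(ℝ, F).tangent 1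
      (fun g : G => (⟨g, mulInvariantVectorField (I := 𝓘(ℝ, F)) ζ g⟩ : TangentBundle 𝓘(ℝ, F) G)) := by
  have : LieGroup 𝓘(ℝ, F) (minSmoothness ℝ 3) G := by
    rw [minSmoothness_of_isRCLikeNormedField]
    infer_instance
  exact (contMDiff_mulInvariantVectorField (I := 𝓘(ℝ, F)) (G := G) ζ).of_le (by
    rw [minSmoothness_of_isRCLikeNormedField]; norm_cast)

theorem LieGroup.t2Space (F : Type*) [NormedAddCommGroup F] [NormedSpace ℝ F]
    (G : Type*) [TopologicalSpace G] [ChartedSpace F G] [Group G] [LieGroup 𝓘(ℝ, F) ∞ G] :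
    T2Space G := by
  have := topologicalGroup_of_lieGroup 𝓘(ℝ, F) ∞ (G := G)
  have := 𝓘(ℝ, F).t1Space G
  infer_instance

/-- Left translates of one local integral curve of the invariant field give integral curves through
every point on the same time interval, so the field is complete. The homomorphism property is
uniqueness applied to `t ↦ γ (s + t)` and `t ↦ γ s * γ t`. -/
theorem exists_isOneParameterSubgroup [CompleteSpace F] (ζ : F) : ∃ γ : ℝ → G, IsOneParameterSubgroup γ ζ := by
  have := LieGroup.t2Space F G
  have := topologicalGroup_of_lieGroup 𝓘(ℝ, F) ∞ (G := G)
  have : IsManifold 𝓘(ℝ, F) 1 G := IsManifold.of_le (n := ∞) (by simp)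
  have hV := contMDiff_mulInvariantVectorField_one (G := G) ζ
  obtain ⟨γ₀, h0, h1⟩ := exists_isMIntegralCurveAt_of_contMDiffAt_boundaryless 0 (hV 1)
  obtain ⟨ε, hε, h1⟩ := isMIntegralCurveAt_iff'.1 h1
  obtain ⟨γ, hγ0, hγ⟩ := exists_isMIntegralCurve_of_isMIntegralCurveOn hV hε (fun x =>
    ⟨fun t => x * γ₀ t, by simp [h0], by
      have := h1.mul_left x
      rwa [Real.ball_eq_Ioo, zero_sub, zero_add] at this⟩) 1
  refine ⟨γ, fun s t => ?_, ?_⟩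
  · have e1 := hγ.comp_add s
    have e2 : IsMIntegralCurve (fun t => γ s * γ t) (mulInvariantVectorField (I := 𝓘(ℝ, F)) (G := G) ζ) := by
      rw [isMIntegralCurve_iff_isMIntegralCurveOn] at hγ ⊢
      exact hγ.mul_left _
    have := isMIntegralCurve_Ioo_eq_of_contMDiff_boundaryless (t₀ := 0) hV e1 e2 (by simp [hγ0])
    have := congrFun this t
    simpa [add_comm] using this
  · have := hγ 0
    refine this.congr_mfderiv ?_
    refine ContinuousLinearMap.ext fun (r : ℝ) => ?_
    have := mulInvariantVectorField_one (G := G) ζ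
    rw [hγ0]
    exact congrArg (fun w : F => r • w) this

omit [LieGroup 𝓘(ℝ, F) ∞ G] in
theorem PrequantumBKS.IsOneParameterSubgroup.map_zero {γ : ℝ → G} {ζ : F} (h : IsOneParameterSubgroup γ ζ) :
    γ 0 = 1 := by
  have := h.1 0 0
  simpa using this

omit [LieGroup 𝓘(ℝ, F) ∞ G] in
theorem PrequantumBKS.IsOneParameterSubgroup.hasMFDerivAt {γ : ℝ → G} {ζ : F}
    (h : IsOneParameterSubgroup γ ζ) {r : ℝ} (hr : r = 0) :
    HasMFDerivAt 𝓘(ℝ, ℝ) 𝓘(ℝ, F) γ r (ContinuousLinearMap.toSpanSingleton ℝ ζ : ℝ →L[ℝ] F) := by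
  subst hr
  exact h.2

/-- Writing `γ r = γ t * γ (r - t)` reduces the derivative at `t` to the one at `0`. This brings
uniqueness of integral curves to bear on one-parameter subgroups. -/
theorem PrequantumBKS.IsOneParameterSubgroup.isMIntegralCurve {γ : ℝ → G} {ζ : F}
    (h : IsOneParameterSubgroup γ ζ) :
    IsMIntegralCurve γ (mulInvariantVectorField (I := 𝓘(ℝ, F)) (G := G) ζ) := by
  intro t
  have h1 : HasMFDerivAt 𝓘(ℝ, ℝ) 𝓘(ℝ, ℝ) (fun r : ℝ => r - t) t (ContinuousLinearMap.id ℝ ℝ) :=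
    ((hasFDerivAt_id t).sub_const t).hasMFDerivAt
  have h2 : HasMFDerivAt 𝓘(ℝ, ℝ) 𝓘(ℝ, F) (fun r => γ (r - t)) t
      (ContinuousLinearMap.toSpanSingleton ℝ ζ : ℝ →L[ℝ] F) :=
    HasMFDerivAt.comp (f := fun r : ℝ => r - t) (g := γ) t (h.hasMFDerivAt (sub_self t)) h1
  have h3 := (mdifferentiableAt_mul_left_const (F := F) (γ t) (γ (t - t))).hasMFDerivAt.comp t h2
  have e : (fun y => γ t * y) ∘ (fun r : ℝ => γ (r - t)) = γ := by
    ext r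
    simp [← h.1]
  rw [e] at h3
  refine h3.congr_mfderiv ?_
  refine ContinuousLinearMap.ext fun (r : ℝ) => ?_
  have e0 : γ (t - t) = 1 := by rw [sub_self, h.map_zero]
  refine (ContinuousLinearMap.map_smul (mfderiv 𝓘(ℝ, F) 𝓘(ℝ, F) (fun y : G => γ t * y) (γ (t - t)) : F →L[ℝ] F) r ζ).trans ?_
  rw [e0]
  rfl

theorem PrequantumBKS.IsOneParameterSubgroup.unique {γ γ' : ℝ → G} {ζ : F} (h : IsOneParameterSubgroup γ ζ)
    (h' : IsOneParameterSubgroup γ' ζ) : γ = γ' := by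
  have := LieGroup.t2Space F G
  have : IsManifold 𝓘(ℝ, F) 1 G := IsManifold.of_le (n := ∞) (by simp)
  exact isMIntegralCurve_Ioo_eq_of_contMDiff_boundaryless (t₀ := 0) (contMDiff_mulInvariantVectorField_one ζ)
    h.isMIntegralCurve h'.isMIntegralCurve (h.map_zero.trans h'.map_zero.symm)

omit [LieGroup 𝓘(ℝ, F) ∞ G] in
theorem PrequantumBKS.IsOneParameterSubgroup.smul {γ : ℝ → G} {ζ : F} (h : IsOneParameterSubgroup γ ζ) (a : ℝ) :
   IsOneParameterSubgroup (fun t => γ (t * a)) (a • ζ) := by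
  refine ⟨fun s t => by simp only [add_mul, h.1], ?_⟩
  have h1 : HasMFDerivAt 𝓘(ℝ, ℝ) 𝓘(ℝ, ℝ) (fun r : ℝ => r * a) 0 (ContinuousLinearMap.toSpanSingleton ℝ a) :=
    ((hasDerivAt_mul_const a).hasFDerivAt).hasMFDerivAt
  refine (HasMFDerivAt.comp (f := fun r : ℝ => r * a) (g := γ) 0
    (h.hasMFDerivAt (zero_mul a)) h1).congr_mfderiv ?_
  refine ContinuousLinearMap.ext fun (r : ℝ) => ?_
  exact mul_smul r a ζ

/-- Uniqueness of one-parameter subgroups makes the choice in the definition of `lieExp` irrelevant.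
-/
theorem PrequantumBKS.IsOneParameterSubgroup.lieExp_eq {γ : ℝ → G} {ζ : F} (h : IsOneParameterSubgroup γ ζ) :
    lieExp (F := F) (G := G) ζ = γ 1 := by
  obtain ⟨γ', h1, h2⟩ := Classical.epsilon_spec (p := fun g : G => ∃ γ : ℝ → G, IsOneParameterSubgroup γ ζ ∧ γ 1 = g) ⟨γ 1, γ, h, rfl⟩
  rw [lieExp, ← h2, h1.unique h]

theorem isOneParameterSubgroup_lieExp [CompleteSpace F] (ζ : F) :
    IsOneParameterSubgroup (fun t : ℝ => lieExp (F := F) (G := G) (t • ζ)) ζ := by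
  obtain ⟨γ, h⟩ := exists_isOneParameterSubgroup (G := G) ζ
  convert h using 2 with t
  rw [(h.smul t).lieExp_eq, one_mul]

end OneParameter

/-! ### The adjoint action on the complexified Lie algebra. -/

section Complexification

attribute [local instance] LieGroup.restrictScalars_complex

variable {E : Type*} [NormedAddCommGroup E] [NormedSpace ℝ E]
  {K : Type*} [TopologicalSpace K] [ChartedSpace E K] [Group K]
  {F : Type*} [NormedAddCommGroup F] [NormedSpace ℂ F]
  {G : Type*} [TopologicalSpace G] [ChartedSpace F G] [Group G]

variable (E F) in
/-- The map `Y ↦ e^{iY}` from the Lie algebra of `K` to the complexification `G`. -/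
noncomputable def imagExp (ι : K →* G) (Y : E) : G := lieExp (F := F) (Complex.I • (lieDiff ι Y : F))

theorem psi_eq (ι : K →* G) (s : ℝ) (p : K × E) : psi F ι s p = ι p.1 * imagExp E F ι (s • p.2) := by
  rw [psi, imagExp, map_smul, mul_comm, mul_smul, Complex.coe_smul]

/-- This map is the restriction of the polar diffeomorphism to `x = 1`, so smoothness of the
exponential map in general is not needed. -/
theorem PrequantumBKS.IsComplexification.contMDiff_imagExp {ι : K →* G} (hι : IsComplexification E F ι) :
    ContMDiff 𝓘(ℝ, E) 𝓘(ℝ, F) ∞ (imagExp E F ι) := by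
  obtain ⟨Φ, hΦ⟩ := hι.polar
  have h : imagExp E F ι = Φ ∘ fun Y : E => ((1 : K), Y) := by
    ext Y
    simp [hΦ, psi_eq]
  rw [h]
  exact Φ.contMDiff.comp (contMDiff_const.prodMk contMDiff_id)

theorem PrequantumBKS.IsComplexification.hasMFDerivAt {ι : K →* G} (hι : IsComplexification E F ι) {x : K}
    (hx : x = 1) : HasMFDerivAt 𝓘(ℝ, E) 𝓘(ℝ, F) (fun y : K => ι y) x (lieDiff ι : E →L[ℝ] F) := by
  subst hx
  exact ((hι.contMDiff 1).mdifferentiableAt (by simp)).hasMFDerivAt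

variable [LieGroup 𝓘(ℂ, F) ∞ G]

theorem isOneParameterSubgroup_imagExp [FiniteDimensional ℂ F] (ι : K →* G) (Y : E) :
    IsOneParameterSubgroup (fun t : ℝ => imagExp E F ι (t • Y)) (Complex.I • (lieDiff ι Y : F)) := by
  have := FiniteDimensional.complete ℂ F
  convert isOneParameterSubgroup_lieExp (G := G) (Complex.I • (lieDiff ι Y : F)) using 2 with t
  rw [imagExp, map_smul, smul_comm]

/-- Conjugation is holomorphic, so the real derivative is complex linear; this is what lets `i` be
pulled out of `Ad` and `ad` below. -/
theorem restrictScalars_adjointAction (g : G) :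
    (adjointAction ℂ F g).restrictScalars ℝ = adjointAction ℝ F g :=
  hasMFDerivAt_unique (hasMFDerivAt_conj g 1 rfl).restrictScalars_complex (hasMFDerivAt_conj g 1 rfl)

theorem hasMFDerivAt_adjointAction_apply {g : G} (hg : g = 1) (w : F) :
    HasMFDerivAt 𝓘(ℝ, F) 𝓘(ℝ, F) (fun g : G => adjointAction ℂ F g w) g
      (((adjointDeriv ℂ F G).flip w).restrictScalars ℝ) := by
  refine HasMFDerivAt.restrictScalars_complex ?_
  exact ((ContinuousLinearMap.apply ℂ F w).hasFDerivAt.hasMFDerivAt.comp g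
    (hasMFDerivAt_adjointAction hg))

/-- `Ad (γ r) = Ad (γ (r - t)) Ad (γ t)` moves the differentiation to time `0`. -/
theorem PrequantumBKS.IsOneParameterSubgroup.hasDerivAt_adjointAction {γ : ℝ → G} {ζ : F}
    (h : IsOneParameterSubgroup γ ζ) (t : ℝ) (w : F) :
    HasDerivAt (fun t => adjointAction ℂ F (γ t) w)
      (adjointDeriv ℂ F G ζ (adjointAction ℂ F (γ t) w)) t := by
  have h0 (w : F) : HasDerivAt (fun t => adjointAction ℂ F (γ t) w) (adjointDeriv ℂ F G ζ w) (t - t) := by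
    have h1 : HasMFDerivAt 𝓘(ℝ, ℝ) 𝓘(ℝ, F) (fun t => adjointAction ℂ F (γ t) w) (t - t)
       ((((adjointDeriv ℂ F G).flip w).restrictScalars ℝ).comp (ContinuousLinearMap.toSpanSingleton ℝ ζ)) :=
      (hasMFDerivAt_adjointAction_apply (by simp [h.map_zero]) w).comp (t - t)
      (h.hasMFDerivAt (sub_self t))
    have h2 : HasFDerivAt (fun t => adjointAction ℂ F (γ t) w)
      ((((adjointDeriv ℂ F G).flip w).restrictScalars ℝ).comp
        (ContinuousLinearMap.toSpanSingleton ℝ ζ) : ℝ →L[ℝ] F) (t - t) := h1.hasFDerivAt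
    simpa using h2.hasDerivAt
  have h1 := (h0 (adjointAction ℂ F (γ t) w)).comp_sub_const t t
  have e : ∀ r, adjointAction ℂ F (γ (r - t)) (adjointAction ℂ F (γ t) w) = adjointAction ℂ F (γ r) w := fun r => by
    rw [← ContinuousLinearMap.comp_apply, ← adjointAction_mul, ← h.1, sub_add_cancel]
  simpa only [e] using h1

variable [LieGroup 𝓘(ℝ, E) ∞ K]

theorem PrequantumBKS.IsComplexification.adjointAction_lieDiff {ι : K →* G} (hι : IsComplexification E F ι)
    (x : K) (u : E) : adjointAction ℂ F (ι x) (lieDiff ι u) = lieDiff ι (adjointAction ℝ E x u) := by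
  have h1 : HasMFDerivAt 𝓘(ℝ, E) 𝓘(ℝ, F) (fun y : K => ι x * ι y * (ι x)⁻¹) 1
      ((adjointAction ℝ F (ι x)).comp (lieDiff ι : E →L[ℝ] F)) :=
    (hasMFDerivAt_conj (ι x) (ι 1) (map_one ι)).comp 1 (hι.hasMFDerivAt rfl)
  have h2 : HasMFDerivAt 𝓘(ℝ, E) 𝓘(ℝ, F) (fun y : K => ι (x * y * x⁻¹)) 1
      ((lieDiff ι : E →L[ℝ] F).comp (adjointAction ℝ E x)) :=
    HasMFDerivAt.comp (g := fun y : K => ι y) 1 (hι.hasMFDerivAt (by simp)) (hasMFDerivAt_conj x 1 rfl)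
  have e : (fun y : K => ι (x * y * x⁻¹)) = fun y : K => ι x * ι y * (ι x)⁻¹ := by
    ext; simp
  rw [e] at h2
  have h3 := DFunLike.congr_fun (hasMFDerivAt_unique h1 h2) u
  rw [← restrictScalars_adjointAction] at h3
  exact h3

/-- Obtained by differentiating `adjointAction_lieDiff` in the group variable. It shows that `ad` of
the complex group is, on the image of `Lie(K)`, given by the real matrix of `ad_Y`. -/
theorem PrequantumBKS.IsComplexification.adjointDeriv_lieDiff {ι : K →* G} (hι : IsComplexification E F ι)
    (Y u : E) : adjointDeriv ℂ F G (lieDiff ι Y) (lieDiff ι u) = lieDiff ι (adjointDeriv ℝ E K Y u) := by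
  have h1 : HasMFDerivAt 𝓘(ℝ, E) 𝓘(ℝ, F) (fun x : K => adjointAction ℂ F (ι x) (lieDiff ι u)) 1
      ((((adjointDeriv ℂ F G).flip (lieDiff ι u)).restrictScalars ℝ).comp (lieDiff ι : E →L[ℝ] F)) :=
    (hasMFDerivAt_adjointAction_apply (map_one ι) _).comp 1 (hι.hasMFDerivAt rfl)
  have h2 : HasMFDerivAt 𝓘(ℝ, E) 𝓘(ℝ, F) (fun x : K => (lieDiff ι (adjointAction ℝ E x u) : F)) 1
      (((lieDiff ι : E →L[ℝ] F).comp (ContinuousLinearMap.apply ℝ E u)).comp (adjointDeriv ℝ E K)) :=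
    ((lieDiff ι : E →L[ℝ] F).comp (ContinuousLinearMap.apply ℝ E u)).hasFDerivAt.hasMFDerivAt.comp 1
      (hasMFDerivAt_adjointAction rfl)
  have e : (fun x : K => adjointAction ℂ F (ι x) (lieDiff ι u)) =
      fun x : K => (lieDiff ι (adjointAction ℝ E x u) : F) := by
    ext; rw [hι.adjointAction_lieDiff]
  rw [e] at h1
  exact DFunLike.congr_fun (hasMFDerivAt_unique h1 h2) Y

/-- The function `x ↦ B (Ad x u) (Ad x v)` is constant; its derivative at `1` in the direction `Y`
is the left-hand side. -/
theorem adjointDeriv_skew [FiniteDimensional ℝ E] (B : LinearMap.BilinForm ℝ E)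
    (hB : ∀ (x : K) (u v : E), B (adjointAction ℝ E x u) (adjointAction ℝ E x v) = B u v) (Y u v : E) :
    B (adjointDeriv ℝ E K Y u) v + B u (adjointDeriv ℝ E K Y v) = 0 := by
  let B' : E →L[ℝ] E →L[ℝ] ℝ := LinearMap.toContinuousLinearMap
    ((LinearMap.toContinuousLinearMap : (E →ₗ[ℝ] ℝ) ≃ₗ[ℝ] (E →L[ℝ] ℝ)).toLinearMap ∘ₗ B)
  have hB' : ∀ u v, B' u v = B u v := fun _ _ => rfl
  have h0 := B'.hasFDerivAt_of_bilinear
    (ContinuousLinearMap.apply ℝ E u).hasFDerivAt (ContinuousLinearMap.apply ℝ E v).hasFDerivAt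
    (x := adjointAction ℝ E (1 : K))
  have h1 := h0.hasMFDerivAt.comp 1 (hasMFDerivAt_adjointAction (𝕜 := ℝ) (F := E) (rfl : (1 : K) = 1))
  have h2 : HasMFDerivAt 𝓘(ℝ, E) 𝓘(ℝ, ℝ) (fun _ : K => B u v) 1 (0 : E →L[ℝ] ℝ) := hasMFDerivAt_const _ _
  have e : (fun S : E →L[ℝ] E => B' ((ContinuousLinearMap.apply ℝ E u) S) ((ContinuousLinearMap.apply ℝ E v) S)) ∘ (adjointAction ℝ E : K → (E →L[ℝ] E)) = fun _ => B u v := by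
    ext x
    simp [hB', hB]
  rw [e] at h1
  have h3 := DFunLike.congr_fun (hasMFDerivAt_unique h1 h2) Y
  have h4 : B u (adjointDeriv ℝ E K Y v) + B (adjointDeriv ℝ E K Y u) v = 0 := by
    have h5 : B' (adjointAction ℝ E (1 : K) u) (adjointDeriv ℝ E K Y v) +
      B' (adjointDeriv ℝ E K Y u) (adjointAction ℝ E (1 : K) v) = 0 := h3
    simpa [adjointAction_one, hB'] using h5
  rw [add_comm, h4]

end Complexification

/-! ### The differential of `ψ_s`. -/

section Polar

attribute [local instance] LieGroup.restrictScalars_complex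

variable {E : Type*} [NormedAddCommGroup E] [NormedSpace ℝ E]
  {K : Type*} [TopologicalSpace K] [ChartedSpace E K] [Group K]
  {F : Type*} [NormedAddCommGroup F] [NormedSpace ℂ F]
  {G : Type*} [TopologicalSpace G] [ChartedSpace F G] [Group G] [LieGroup 𝓘(ℂ, F) ∞ G]

variable (F) in
/-- The left logarithmic derivative at `Y` of `Z ↦ e^{isZ}`. -/
noncomputable def imagExpDeriv (ι : K →* G) (Y : E) (s : ℝ) : E →L[ℝ] F :=
  s • leftLogDeriv ℝ F (imagExp E F ι) (s • Y)

theorem PrequantumBKS.IsComplexification.hasMFDerivAt_imagExpDeriv {ι : K →* G} (hι : IsComplexification E F ι)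
    (Y : E) (s : ℝ) :
    HasMFDerivAt 𝓘(ℝ, E) 𝓘(ℝ, F) (fun Z : E => (imagExp E F ι (s • Y))⁻¹ * imagExp E F ι (s • Z)) Y
      (imagExpDeriv F ι Y s : E →L[ℝ] F) := by
  have h1 : HasMFDerivAt 𝓘(ℝ, E) 𝓘(ℝ, F) (fun Z : E => (imagExp E F ι (s • Y))⁻¹ * imagExp E F ι Z) (s • Y)
      (leftLogDeriv ℝ F (imagExp E F ι) (s • Y) : E →L[ℝ] F) := by
    refine MDifferentiableAt.hasMFDerivAt ?_
    exact ((contMDiff_const.mul hι.contMDiff_imagExp).mdifferentiable (n := ∞) (by simp)) _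
  have h2 : HasMFDerivAt 𝓘(ℝ, E) 𝓘(ℝ, E) (fun Z : E => s • Z) Y (s • ContinuousLinearMap.id ℝ E) :=
    ((hasFDerivAt_id Y).const_smul s).hasMFDerivAt
  refine (HasMFDerivAt.comp (f := fun Z : E => s • Z) Y h1 h2).congr_mfderiv ?_
  refine ContinuousLinearMap.ext fun (v : E) => ?_
  exact (leftLogDeriv ℝ F (imagExp E F ι) (s • Y)).map_smul s v

theorem PrequantumBKS.IsComplexification.continuous_imagExpDeriv {ι : K →* G} (hι : IsComplexification E F ι)
    (s : ℝ) : Continuous fun Y : E => imagExpDeriv F ι Y s := by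
  have h : Continuous (leftLogDeriv ℝ F (imagExp E F ι)) := continuous_iff_continuousAt.2 fun Y =>
    (contDiffAt_leftLogDeriv (hι.contMDiff_imagExp Y)).continuousAt
  exact (h.comp (continuous_const_smul s)).const_smul s

variable [FiniteDimensional ℂ F]

theorem imagExp_add_smul (ι : K →* G) (Y : E) (s t : ℝ) :
    imagExp E F ι ((s + t) • Y) = imagExp E F ι (s • Y) * imagExp E F ι (t • Y) :=
  (isOneParameterSubgroup_imagExp ι Y).1 s t

theorem imagExp_zero (ι : K →* G) : imagExp E F ι 0 = 1 := by
  simpa using (isOneParameterSubgroup_imagExp ι (0 : E)).map_zero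

theorem imagExp_neg_smul (ι : K →* G) (Y : E) (s : ℝ) :
    imagExp E F ι ((-s) • Y) = (imagExp E F ι (s • Y))⁻¹ := by
  rw [eq_inv_iff_mul_eq_one, ← imagExp_add_smul, neg_add_cancel, zero_smul, imagExp_zero]

/-- This cocycle identity comes from `e^{-i(s+t)Y} e^{i(s+t)Z} = [e^{-itY} (e^{-isY} e^{isZ})
e^{itY}] · [e^{-itY} e^{itZ}]`, both factors being `1` at `Z = Y`. Its derivative in `t` at `0` is
the differential equation for `Q_s`. -/
theorem PrequantumBKS.IsComplexification.imagExpDeriv_add {ι : K →* G} (hι : IsComplexification E F ι)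
    (Y : E) (s t : ℝ) :
    imagExpDeriv F ι Y (s + t) =
      (adjointAction ℝ F (imagExp E F ι (t • Y))⁻¹).comp (imagExpDeriv F ι Y s) + imagExpDeriv F ι Y t := by
  have h1 := (hasMFDerivAt_conj (𝕜 := ℝ) (F := F) (imagExp E F ι (t • Y))⁻¹ _ (inv_mul_cancel (imagExp E F ι (s • Y)))).comp Y
    (hι.hasMFDerivAt_imagExpDeriv Y s)
  have h2 := h1.mul_of_eq_one (hι.hasMFDerivAt_imagExpDeriv Y t) (by simp) (by simp)
  refine hasMFDerivAt_unique (hι.hasMFDerivAt_imagExpDeriv Y (s + t))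
    (h2.congr_of_eventuallyEq (Filter.Eventually.of_forall fun Z => ?_))
  simp only [imagExp_add_smul, Function.comp]
  group

theorem PrequantumBKS.IsComplexification.leftLogDeriv_imagExp_zero {ι : K →* G} (hι : IsComplexification E F ι)
    (Z : E) : leftLogDeriv ℝ F (imagExp E F ι) 0 Z = Complex.I • (lieDiff ι Z : F) := by
  have h1 : HasMFDerivAt 𝓘(ℝ, E) 𝓘(ℝ, F) (imagExp E F ι) ((fun t : ℝ => t • Z) 0)
      (leftLogDeriv ℝ F (imagExp E F ι) 0 : E →L[ℝ] F) := by
    have h2 := (hι.contMDiff_imagExp.mdifferentiable (by simp) ((fun t : ℝ => t • Z) 0)).hasMFDerivAt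
    refine h2.congr_mfderiv ?_
    have e : (fun Z => (imagExp E F ι (0 : E))⁻¹ * imagExp E F ι Z) = imagExp E F ι := by
      ext; simp [imagExp_zero]
    have e2 : (fun t : ℝ => t • Z) 0 = 0 := zero_smul _ _
    change _ = mfderiv 𝓘(ℝ, E) 𝓘(ℝ, F) (fun Z => (imagExp E F ι (0 : E))⁻¹ * imagExp E F ι Z) 0
    rw [e, e2]
  have h3 : HasMFDerivAt 𝓘(ℝ, ℝ) 𝓘(ℝ, E) (fun t : ℝ => t • Z) 0 (ContinuousLinearMap.toSpanSingleton ℝ Z) :=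
    (ContinuousLinearMap.toSpanSingleton ℝ Z).hasFDerivAt.hasMFDerivAt
  have h4 := hasMFDerivAt_unique (HasMFDerivAt.comp (f := fun t : ℝ => t • Z) 0 h1 h3)
    (isOneParameterSubgroup_imagExp ι Z).2
  have h5 : leftLogDeriv ℝ F (imagExp E F ι) 0 ((1 : ℝ) • Z) =
      (1 : ℝ) • Complex.I • (lieDiff ι Z : F) := DFunLike.congr_fun h4 (1 : ℝ)
  rwa [one_smul, one_smul] at h5

theorem PrequantumBKS.IsComplexification.hasDerivAt_imagExpDeriv {ι : K →* G} (hι : IsComplexification E F ι)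
    (Y Z : E) (s : ℝ) :
    HasDerivAt (fun s => imagExpDeriv F ι Y s Z)
      (-(Complex.I • adjointDeriv ℂ F G (lieDiff ι Y) (imagExpDeriv F ι Y s Z)) + Complex.I • (lieDiff ι Z : F)) s := by
  have h0 : HasDerivAt (fun h => imagExpDeriv F ι Y h Z) (Complex.I • (lieDiff ι Z : F)) 0 := by
    have hc : ContinuousAt (fun h : ℝ => leftLogDeriv ℝ F (imagExp E F ι) (h • Y) Z) 0 := by
      have h1 : ContinuousAt (leftLogDeriv ℝ F (imagExp E F ι)) ((0 : ℝ) • Y) :=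
        (contDiffAt_leftLogDeriv (hι.contMDiff_imagExp _)).continuousAt
      exact (h1.comp (f := fun h : ℝ => h • Y) (by fun_prop)).clm_apply continuousAt_const
    -- The difference quotient is exactly the logarithmic derivative at `h • Y`, so continuity alone
    -- gives the limit.
    rw [hasDerivAt_iff_tendsto_slope]
    have h2 := hc.tendsto.mono_left (nhdsWithin_le_nhds (s := {0}ᶜ))
    rw [zero_smul, hι.leftLogDeriv_imagExp_zero] at h2
    refine h2.congr' ?_
    filter_upwards [self_mem_nhdsWithin] with h hh
    simp [slope, imagExpDeriv, smul_smul, inv_mul_cancel₀ (show h ≠ 0 from hh)]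
  have h1 : HasDerivAt (fun h : ℝ => adjointAction ℂ F (imagExp E F ι (h • Y))⁻¹ (imagExpDeriv F ι Y s Z))
      (-(Complex.I • adjointDeriv ℂ F G (lieDiff ι Y) (imagExpDeriv F ι Y s Z))) 0 := by
    have h2 := ((isOneParameterSubgroup_imagExp ι Y).hasDerivAt_adjointAction (-0)
      (imagExpDeriv F ι Y s Z)).scomp (0 : ℝ) (hasDerivAt_neg (0 : ℝ))
    simp only [Function.comp_def, imagExp_neg_smul] at h2
    simpa [adjointAction_one, imagExp_zero] using h2
  have h2 : HasDerivAt (fun h => imagExpDeriv F ι Y (s + h) Z)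
     (-(Complex.I • adjointDeriv ℂ F G (lieDiff ι Y) (imagExpDeriv F ι Y s Z)) + Complex.I • (lieDiff ι Z : F)) (s - s) := by
    rw [sub_self]
    refine (h1.add h0).congr_of_eventuallyEq (Filter.Eventually.of_forall fun h => ?_)
    simp [hι.imagExpDeriv_add, ← restrictScalars_adjointAction]
  simpa using h2.comp_sub_const s s

omit [FiniteDimensional ℂ F] in
-- With `p = (x, Y)` and `q = (x', Y')`, `ψ_s(p)⁻¹ ψ_s(q) = [e^{-isY} ι(x⁻¹x') e^{isY}] · [e^{-isY}
-- e^{isY'}]`; each factor depends on one variable and is `1` at `q = p`.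
theorem PrequantumBKS.IsComplexification.psiDiff_apply [LieGroup 𝓘(ℝ, E) ∞ K] {ι : K →* G} (hι : IsComplexification E F ι)
    (s : ℝ) (p : K × E) (v : E × E) :
    (psiDiff F ι s p v : F) =
      adjointAction ℂ F (imagExp E F ι (s • p.2))⁻¹ (lieDiff ι (leftTriv p.1 v.1)) + imagExpDeriv F ι p.2 s v.2 := by
  have h1 : HasMFDerivAt 𝓘(ℝ, E) 𝓘(ℝ, E) (fun y : K => p.1⁻¹ * y) p.1 (leftTriv p.1 : E →L[ℝ] E) :=
    (mdifferentiableAt_mul_left_const (F := E) p.1⁻¹ p.1).hasMFDerivAt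
  have h2 : HasMFDerivAt (modelT E) 𝓘(ℝ, E) (fun q : K × E => q.1) p (ContinuousLinearMap.fst ℝ E E) :=
    hasMFDerivAt_fst p
  have h3 : HasMFDerivAt (modelT E) 𝓘(ℝ, E) (fun q : K × E => q.2) p (ContinuousLinearMap.snd ℝ E E) :=
    hasMFDerivAt_snd p
  have h4 := (hasMFDerivAt_conj (𝕜 := ℝ) (F := F) (imagExp E F ι (s • p.2))⁻¹ (ι (p.1⁻¹ * p.1)) (by simp)).comp p
    ((hι.hasMFDerivAt (inv_mul_cancel p.1)).comp p (h1.comp p h2))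
  have h5 := (hι.hasMFDerivAt_imagExpDeriv p.2 s).comp p h3
  have h6 := h4.mul_of_eq_one h5 (by simp) (by simp)
  have h7 : HasMFDerivAt (modelT E) 𝓘(ℝ, F)
      (fun q : K × E => (psi F ι s p)⁻¹ * psi F ι s q) p _ :=
    h6.congr_of_eventuallyEq (Filter.Eventually.of_forall fun q => by
      simp only [psi_eq, Function.comp, map_mul, map_inv]
      group)
  refine (DFunLike.congr_fun h7.mfderiv v).trans ?_
  rw [← restrictScalars_adjointAction]
  rfl

end Polar

/-! ### The matrices of `η̃_s` in the left-invariant frame. -/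

theorem leftTriv_mfderiv_mul_left {E : Type*} [NormedAddCommGroup E] [NormedSpace ℝ E]
    {K : Type*} [TopologicalSpace K] [ChartedSpace E K] [Group K] [LieGroup 𝓘(ℝ, E) ∞ K]
    (x : K) (v : E) :
    (leftTriv x (mfderiv 𝓘(ℝ, E) 𝓘(ℝ, E) (fun y : K => x * y) 1 v) : E) = v := by
  have h := (mdifferentiableAt_mul_left_const (F := E) x⁻¹ (x * 1)).hasMFDerivAt.comp 1
    (mdifferentiableAt_mul_left_const (F := E) x 1).hasMFDerivAt
  have e : (fun y => x⁻¹ * y) ∘ (fun y => x * y) = id := by ext y; simp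
  have h2 := h.mfderiv.symm.trans (mfderiv_eq_id_of_eq_id e (1 : K))
  have h3 := DFunLike.congr_fun h2 v
  have e2 : x * 1 = x := mul_one _
  rw [e2] at h3
  exact h3

section Frame

attribute [local instance] LieGroup.restrictScalars_complex

variable {E : Type*} [NormedAddCommGroup E] [NormedSpace ℝ E]
  {K : Type*} [TopologicalSpace K] [ChartedSpace E K] [Group K]
  {F : Type*} [NormedAddCommGroup F] [NormedSpace ℂ F]
  {G : Type*} [TopologicalSpace G] [ChartedSpace F G] [Group G]
  {n : ℕ}

theorem sum_smul_lieDiff (ι : K →* G) (X : Module.Basis (Fin n) ℝ E) (c : Fin n → ℂ) :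
    ∑ j, c j • (lieDiff ι (X j) : F) =
      complexifiedDiff ι (∑ j, (c j).re • X j, ∑ j, (c j).im • X j) := by
  simp only [complexifiedDiff, map_sum, map_smul, Finset.smul_sum, ← Finset.sum_add_distrib]
  refine Finset.sum_congr rfl fun j _ => ?_
  conv_lhs => rw [← Complex.re_add_im (c j)]
  rw [add_smul, Complex.coe_smul, mul_comm, mul_smul, Complex.coe_smul]

/-- The complex basis `dι X₁, …, dι Xₙ` of the Lie algebra of the complexification. -/
noncomputable def PrequantumBKS.IsComplexification.basis {ι : K →* G} (hι : IsComplexification E F ι)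
    (X : Module.Basis (Fin n) ℝ E) : Module.Basis (Fin n) ℂ F :=
  Module.Basis.mk (v := fun j => (lieDiff ι (X j) : F))
    (by
      rw [Fintype.linearIndependent_iff]
      intro c hc j
      rw [sum_smul_lieDiff] at hc
      have h0 : complexifiedDiff (E := E) (F := F) ι (0, 0) = 0 := by simp [complexifiedDiff]
      have h := hι.bijective_complexifiedDiff.1 (hc.trans h0.symm)
      rw [Prod.mk.injEq] at h
      exact Complex.ext (Fintype.linearIndependent_iff.1 X.linearIndependent _ h.1 j)
        (Fintype.linearIndependent_iff.1 X.linearIndependent _ h.2 j))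
    (by
      intro ζ _
      obtain ⟨⟨u, v⟩, rfl⟩ := hι.bijective_complexifiedDiff.2 ζ
      have h := sum_smul_lieDiff (F := F) ι X (fun j => ⟨X.repr u j, X.repr v j⟩)
      simp only [X.sum_repr] at h
      rw [← h]
      exact Submodule.sum_mem _ fun j _ => Submodule.smul_mem _ _ (Submodule.subset_span ⟨j, rfl⟩))

theorem PrequantumBKS.IsComplexification.basis_apply {ι : K →* G} (hι : IsComplexification E F ι)
    (X : Module.Basis (Fin n) ℝ E) (j : Fin n) : hι.basis X j = lieDiff ι (X j) := by
  simp [IsComplexification.basis]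

theorem PrequantumBKS.IsComplexification.complexCoord_eq {ι : K →* G} (hι : IsComplexification E F ι)
    (X : Module.Basis (Fin n) ℝ E) (j : Fin n) (ζ : F) :
    complexCoord F ι X j ζ = (hι.basis X).repr ζ j := by
  have h := sum_smul_lieDiff (F := F) ι X (fun j => (hι.basis X).repr ζ j)
  simp only [← hι.basis_apply X, (hι.basis X).sum_repr] at h
  rw [complexCoord]
  conv_lhs => rw [h]
  rw [Function.leftInverse_invFun hι.bijective_complexifiedDiff.1]
  simp [Finsupp.single_apply, Complex.ext_iff]

theorem PrequantumBKS.IsComplexification.lieDiff_repr {ι : K →* G} (hι : IsComplexification E F ι)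
    (X : Module.Basis (Fin n) ℝ E) (u : E) (j : Fin n) :
    (hι.basis X).repr (lieDiff ι u) j = X.repr u j := by
  conv_lhs => rw [← X.sum_repr u]
  simp only [map_sum, map_smul, ← hι.basis_apply X, ← Complex.coe_smul]
  simp [Finsupp.single_apply]

variable [FiniteDimensional ℂ F] [LieGroup 𝓘(ℝ, E) ∞ K] [LieGroup 𝓘(ℂ, F) ∞ G]

variable (K) in
/-- The matrix of `i ad_Y`. -/
noncomputable def imagAdMatrix (X : Module.Basis (Fin n) ℝ E) (Y : E) : Matrix (Fin n) (Fin n) ℂ :=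
  Matrix.of fun j k => Complex.I * X.repr (adjointDeriv ℝ E K Y (X k)) j

/-- In an orthonormal basis `ad_Y` is real and skew-symmetric. The Hermitian half gives
diagonalization; the purely imaginary half gives trace zero and the rule that conjugation reverses
`s`. -/
theorem imagAdMatrix_isHermitian [FiniteDimensional ℝ E] (B : LinearMap.BilinForm ℝ E)
    (hB_Ad : ∀ (x : K) (u v : E), B (Ad x u) (Ad x v) = B u v)
    (hB_symm : ∀ u v, B u v = B v u)
    (X : Module.Basis (Fin n) ℝ E) (hX : ∀ i j, B (X i) (X j) = if i = j then 1 else 0) (Y : E) :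
    (imagAdMatrix K X Y).IsHermitian ∧ (imagAdMatrix K X Y).map (starRingEnd ℂ) = -imagAdMatrix K X Y := by
  have hr : ∀ u j, X.repr u j = B u (X j) := fun u j => by
    conv_rhs => rw [← X.sum_repr u]
    simp only [map_sum, map_smul, LinearMap.sum_apply, LinearMap.smul_apply, hX]
    simp
  have hs : ∀ j k, X.repr (adjointDeriv ℝ E K Y (X k)) j = - X.repr (adjointDeriv ℝ E K Y (X j)) k := fun j k => by
    have := adjointDeriv_skew B hB_Ad Y (X k) (X j)
    rw [hr, hr, hB_symm _ (X k)]
    linarith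
  constructor
  · ext j k
    simp only [Matrix.conjTranspose_apply, imagAdMatrix, Matrix.of_apply, star_mul', Complex.star_def,
      Complex.conj_I, Complex.conj_ofReal]
    rw [hs j k]
    push_cast
    ring
  · ext j k
    simp [imagAdMatrix]

/-- The matrix of `Ad(e^{-isY})`. -/
noncomputable def PrequantumBKS.IsComplexification.adMatrix {ι : K →* G} (hι : IsComplexification E F ι)
    (X : Module.Basis (Fin n) ℝ E) (Y : E) (s : ℝ) : Matrix (Fin n) (Fin n) ℂ :=
  Matrix.of fun j k => (hι.basis X).repr (adjointAction ℂ F (imagExp E F ι (s • Y))⁻¹ (lieDiff ι (X k))) j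

/-- The matrix of the left logarithmic derivative of `Y ↦ e^{isY}`. -/
noncomputable def PrequantumBKS.IsComplexification.imagExpMatrix {ι : K →* G} (hι : IsComplexification E F ι)
    (X : Module.Basis (Fin n) ℝ E) (Y : E) (s : ℝ) : Matrix (Fin n) (Fin n) ℂ :=
  Matrix.of fun j k => (hι.basis X).repr (imagExpDeriv F ι Y s (X k)) j

section
variable {ι : K →* G} (hι : IsComplexification E F ι) (X : Module.Basis (Fin n) ℝ E) (Y : E)
include hι

omit [FiniteDimensional ℂ F] in
theorem PrequantumBKS.IsComplexification.adjointDeriv_repr (w : F) (j : Fin n) :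
    (hι.basis X).repr (Complex.I • adjointDeriv ℂ F G (lieDiff ι Y) w) j =
      ∑ k, imagAdMatrix K X Y j k * (hι.basis X).repr w k := by
  conv_lhs => rw [← (hι.basis X).sum_repr w]
  simp only [map_sum, map_smul, hι.basis_apply, Finset.smul_sum, hι.adjointDeriv_lieDiff, Finsupp.coe_finsetSum,
    Finset.sum_apply, Finsupp.smul_apply, hι.lieDiff_repr, imagAdMatrix, Matrix.of_apply, smul_eq_mul]
  refine Finset.sum_congr rfl fun k _ => ?_
  ring

omit [LieGroup 𝓘(ℝ, E) ∞ K] [LieGroup 𝓘(ℂ, F) ∞ G] in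
theorem PrequantumBKS.IsComplexification.hasDerivAt_repr {f : ℝ → F} {f' : F} {s : ℝ} (h : HasDerivAt f f' s)
    (j : Fin n) : HasDerivAt (fun s => (hι.basis X).repr (f s) j) ((hι.basis X).repr f' j) s := by
  have h2 := (((LinearMap.toContinuousLinearMap ((hι.basis X).coord j)).restrictScalars ℝ).hasFDerivAt (x := f s)).comp_hasDerivAt s h
  exact h2

theorem PrequantumBKS.IsComplexification.hasDerivAt_adMatrix (s : ℝ) (j k : Fin n) :
    HasDerivAt (fun s => hι.adMatrix X Y s j k) (-(imagAdMatrix K X Y * hι.adMatrix X Y s) j k) s := by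
  have h := ((isOneParameterSubgroup_imagExp (F := F) ι Y).hasDerivAt_adjointAction (-s)
      (lieDiff ι (X k))).scomp s (hasDerivAt_neg s)
  simp only [Function.comp_def, imagExp_neg_smul] at h
  rw [neg_one_smul, map_smul, smul_apply] at h
  have h2 := hι.hasDerivAt_repr X h j
  refine h2.congr_deriv ?_
  rw [map_neg, Finsupp.neg_apply, hι.adjointDeriv_repr, Matrix.mul_apply]
  rfl

omit [LieGroup 𝓘(ℝ, E) ∞ K] in
theorem PrequantumBKS.IsComplexification.adMatrix_zero : hι.adMatrix X Y 0 = 1 := by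
  ext j k
  simp [adMatrix, imagExp_zero, adjointAction_one, ← hι.basis_apply, Finsupp.single_apply, Matrix.one_apply, eq_comm]

theorem PrequantumBKS.IsComplexification.hasDerivAt_imagExpMatrix (s : ℝ) (j k : Fin n) :
    HasDerivAt (fun s => hι.imagExpMatrix X Y s j k)
      (-(imagAdMatrix K X Y * hι.imagExpMatrix X Y s) j k + Complex.I * (1 : Matrix (Fin n) (Fin n) ℂ) j k) s := by
  have h2 := hι.hasDerivAt_repr X (hι.hasDerivAt_imagExpDeriv Y (X k) s) j
  refine h2.congr_deriv ?_
  rw [map_add, map_neg, Finsupp.add_apply, Finsupp.neg_apply, hι.adjointDeriv_repr, Matrix.mul_apply, map_smul,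
    Finsupp.smul_apply, hι.lieDiff_repr, Matrix.one_apply]
  simp [Finsupp.single_apply, eq_comm, imagExpMatrix, apply_ite Complex.ofReal]

omit [FiniteDimensional ℂ F] [LieGroup 𝓘(ℝ, E) ∞ K] [LieGroup 𝓘(ℂ, F) ∞ G] in
theorem PrequantumBKS.IsComplexification.imagExpMatrix_zero : hι.imagExpMatrix X Y 0 = 0 := by
  ext j k
  simp [imagExpMatrix, imagExpDeriv]

omit [LieGroup 𝓘(ℝ, E) ∞ K] in
theorem PrequantumBKS.IsComplexification.continuous_imagExpMatrix (s : ℝ) (j k : Fin n) :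
    Continuous fun Y => hι.imagExpMatrix X Y s j k := by
  have h := (hι.continuous_imagExpDeriv s).clm_apply (continuous_const (y := X k))
  exact (LinearMap.toContinuousLinearMap ((hι.basis X).coord j)).continuous.comp h

omit [FiniteDimensional ℂ F] in
-- By `psiDiff_apply` the `K`-directions see only `Ad(e^{-isY})` and the fibre directions only the
-- logarithmic derivative, which produces the blocks.
theorem PrequantumBKS.IsComplexification.OmegaBarWedgeOmega_leftFrame [FiniteDimensional ℝ E] (s s' : ℝ) (p : K × E) :
    OmegaBarWedgeOmega F ι X s s' p (leftFrame X p) =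
      (Matrix.fromBlocks ((hι.adMatrix X p.2 s).map (starRingEnd ℂ)) ((hι.imagExpMatrix X p.2 s).map (starRingEnd ℂ))
        (hι.adMatrix X p.2 s') (hι.imagExpMatrix X p.2 s')).det := by
  have h1 : ∀ i, (leftTriv p.1 (mfderiv 𝓘(ℝ, E) 𝓘(ℝ, E) (fun y : K => p.1 * y) 1 (X i)) : E) = X i :=
    fun i => leftTriv_mfderiv_mul_left p.1 (X i)
  have hl : ∀ s j i, etaForm F ι X s j p (leftFrame X p (Fin.castAdd n i)) = hι.adMatrix X p.2 s j i := by
    intro s j i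
    have hf : leftFrame X p (Fin.castAdd n i) =
      ((mfderiv 𝓘(ℝ, E) 𝓘(ℝ, E) (fun y : K => p.1 * y) 1 (X i), (0 : E)) : E × E) := Fin.append_left _ _ _
    rw [etaForm, hι.complexCoord_eq, hf]
    refine (congrArg (fun w : F => (hι.basis X).repr w j) (hι.psiDiff_apply s p _)).trans ?_
    simp only [h1, map_zero, add_zero]
    rfl
  have hr : ∀ s j i, etaForm F ι X s j p (leftFrame X p (Fin.natAdd n i)) = hι.imagExpMatrix X p.2 s j i := by
    intro s j i
    have hf : leftFrame X p (Fin.natAdd n i) = (((0 : E), X i) : E × E) := Fin.append_right _ _ _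
    rw [etaForm, hι.complexCoord_eq, hf]
    refine (congrArg (fun w : F => (hι.basis X).repr w j) (hι.psiDiff_apply s p _)).trans ?_
    have h0 : (leftTriv p.1 (0 : E) : E) = 0 := ContinuousLinearMap.map_zero _
    simp only [h0, map_zero, zero_add]
    rfl
  rw [OmegaBarWedgeOmega, wedgeOneForms, ← Matrix.det_reindex_self finSumFinEquiv.symm]
  congr 1
  ext (j | j) (i | i) <;>
    simp only [Matrix.reindex_apply, Matrix.submatrix_apply, Equiv.symm_symm, Matrix.of_apply,
      finSumFinEquiv_apply_left, finSumFinEquiv_apply_right, Fin.append_left, Fin.append_right, hl, hr,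
      Matrix.fromBlocks_apply₁₁, Matrix.fromBlocks_apply₁₂, Matrix.fromBlocks_apply₂₁,
      Matrix.fromBlocks_apply₂₂, Matrix.map_apply]

end
end Frame

/-! ### The scalar equation `f' = -l f + c`. -/

section LinearODE

/-- The integral `∫₀ʳ e^{-lu} du`. -/
noncomputable def expIntegral (l r : ℝ) : ℝ := if l = 0 then r else (1 - Real.exp (-(l * r))) / l

theorem mul_expIntegral (l r : ℝ) : l * expIntegral l r = 1 - Real.exp (-(l * r)) := by
  rw [expIntegral]
  split_ifs with h
  · simp [h]
  · field_simp

theorem hasDerivAt_exp_neg_mul (l r : ℝ) :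
    HasDerivAt (fun r => Real.exp (-(l * r))) (-l * Real.exp (-(l * r))) r := by
  have := (((hasDerivAt_id r).const_mul l).neg).exp
  refine this.congr_deriv ?_
  simp; ring

theorem hasDerivAt_expIntegral (l r : ℝ) : HasDerivAt (expIntegral l) (Real.exp (-(l * r))) r := by
  by_cases h : l = 0
  · have e : expIntegral l = id := by ext r; simp [expIntegral, h]
    rw [e, h]
    simpa using hasDerivAt_id r
  · have e : expIntegral l = fun r => (1 - Real.exp (-(l * r))) / l := by ext r; simp [expIntegral, h]
    rw [e]
    refine (((hasDerivAt_exp_neg_mul l r).const_sub 1).div_const l).congr_deriv ?_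
    field_simp

theorem expIntegral_zero (l : ℝ) : expIntegral l 0 = 0 := by
  simp [expIntegral]

theorem expIntegral_pos (l : ℝ) {r : ℝ} (hr : 0 < r) : 0 < expIntegral l r := by
  have hm : StrictMono (expIntegral l) := strictMono_of_deriv_pos fun x => by
    rw [(hasDerivAt_expIntegral l x).deriv]; positivity
  simpa [expIntegral_zero] using hm hr

/-- Splits the integral at `s`. No sign is imposed on `s` and `t`, and the determinant computation
uses it with a negated argument. -/
theorem expIntegral_add (l s t : ℝ) :
    expIntegral l (s + t) = expIntegral l s + Real.exp (-(l * s)) * expIntegral l t := by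
  by_cases h : l = 0
  · simp [expIntegral, h]
  · apply mul_left_cancel₀ h
    have h1 := mul_expIntegral l s
    have h2 := mul_expIntegral l t
    have h3 : Real.exp (-(l * (s + t))) = Real.exp (-(l * s)) * Real.exp (-(l * t)) := by
      rw [← Real.exp_add]; ring_nf
    rw [mul_expIntegral, h3]
    linear_combination -h1 - Real.exp (-(l * s)) * h2

theorem eq_of_hasDerivAt_linear {f : ℝ → ℂ} {l : ℝ} {c : ℂ}
    (hf : ∀ s, HasDerivAt f (-(l * f s) + c) s) (s : ℝ) :
    f s = Real.exp (-(l * s)) * f 0 + c * expIntegral l s := by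
  have h1 : ∀ s, HasDerivAt (fun s => (Real.exp (-(-l * s)) : ℂ) * (f s - c * expIntegral l s)) 0 s := fun s => by
    have e1 := (hasDerivAt_exp_neg_mul (-l) s).ofReal_comp
    have e2 := (hasDerivAt_expIntegral l s).ofReal_comp
    refine (e1.mul ((hf s).fun_sub (e2.const_mul c))).congr_deriv ?_
    have h := congrArg (Complex.ofReal) (mul_expIntegral l s)
    push_cast at h ⊢
    linear_combination -Complex.exp (-(-l * s)) * c * h
  have h2 := is_const_of_deriv_eq_zero (fun s => (h1 s).differentiableAt) (fun s => (h1 s).deriv) s 0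
  simp only [mul_zero, neg_zero, Real.exp_zero, expIntegral_zero, Complex.ofReal_zero, sub_zero,
    Complex.ofReal_one, one_mul] at h2
  rw [← h2, ← mul_assoc, ← Complex.ofReal_mul, ← Real.exp_add]
  simp

end LinearODE

/-! ### The matrix equation `S' = -HS + c` and the block determinant. -/

section MatrixODE

variable {m : Type*} [Fintype m] [DecidableEq m]

/-- The function `f` of the Hermitian matrix `H`, given by its values on the eigenvalues of `H`. -/
noncomputable def Matrix.IsHermitian.conjDiagonal {H : Matrix m m ℂ} (hH : H.IsHermitian) (d : m → ℂ) : Matrix m m ℂ :=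
  (hH.eigenvectorUnitary : Matrix m m ℂ) * Matrix.diagonal d * star (hH.eigenvectorUnitary : Matrix m m ℂ)

section
variable {H : Matrix m m ℂ} (hH : H.IsHermitian)

theorem Matrix.IsHermitian.conjDiagonal_eigenvalues :
    hH.conjDiagonal (fun j => (hH.eigenvalues j : ℂ)) = H := by
  conv_rhs => rw [hH.spectral_theorem, Unitary.conjStarAlgAut_apply]
  rfl

theorem Matrix.IsHermitian.conjDiagonal_mul (d e : m → ℂ) :
    hH.conjDiagonal d * hH.conjDiagonal e = hH.conjDiagonal (d * e) := by
  have h : star (hH.eigenvectorUnitary : Matrix m m ℂ) * hH.eigenvectorUnitary = 1 := Unitary.coe_star_mul_self _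
  have h2 : Matrix.diagonal (d * e) = Matrix.diagonal d * Matrix.diagonal e := (Matrix.diagonal_mul_diagonal d e).symm
  simp only [conjDiagonal, h2]
  simp only [Matrix.mul_assoc]
  rw [← Matrix.mul_assoc (star _) (hH.eigenvectorUnitary : Matrix m m ℂ), h, Matrix.one_mul]

theorem Matrix.IsHermitian.conjDiagonal_sub (d e : m → ℂ) :
    hH.conjDiagonal d - hH.conjDiagonal e = hH.conjDiagonal (d - e) := by
  simp only [conjDiagonal, ← Matrix.sub_mul, ← Matrix.mul_sub, Matrix.diagonal_sub]
  rfl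

theorem Matrix.IsHermitian.conjDiagonal_one : hH.conjDiagonal 1 = 1 := by
  have h : (hH.eigenvectorUnitary : Matrix m m ℂ) * star (hH.eigenvectorUnitary : Matrix m m ℂ) = 1 :=
    Unitary.coe_mul_star_self _
  have h2 : Matrix.diagonal (1 : m → ℂ) = 1 := Matrix.diagonal_one
  rw [conjDiagonal, h2, Matrix.mul_one, h]

theorem Matrix.IsHermitian.det_conjDiagonal (d : m → ℂ) : (hH.conjDiagonal d).det = ∏ j, d j := by
  have h : star (hH.eigenvectorUnitary : Matrix m m ℂ) * hH.eigenvectorUnitary = 1 := Unitary.coe_star_mul_self _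
  rw [conjDiagonal, Matrix.det_mul_comm, ← Matrix.mul_assoc, h, Matrix.one_mul, Matrix.det_diagonal]

/-- All four blocks are diagonal in one eigenbasis, so the Schur complement formula reduces to `2 ×
2` determinants. -/
theorem Matrix.IsHermitian.det_fromBlocks_conjDiagonal (a b c d : m → ℂ) (ha : ∀ j, a j ≠ 0) :
    (Matrix.fromBlocks (hH.conjDiagonal a) (hH.conjDiagonal b) (hH.conjDiagonal c) (hH.conjDiagonal d)).det =
      ∏ j, (a j * d j - c j * b j) := by
  have hi : a⁻¹ * a = 1 := by ext j; simp [ha]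
  have hi' : a * a⁻¹ = 1 := by ext j; simp [ha]
  let : Invertible (hH.conjDiagonal a) := ⟨hH.conjDiagonal a⁻¹,
    by rw [conjDiagonal_mul, hi, conjDiagonal_one], by rw [conjDiagonal_mul, hi', conjDiagonal_one]⟩
  have e : ⅟(hH.conjDiagonal a) = hH.conjDiagonal a⁻¹ := rfl
  rw [Matrix.det_fromBlocks₁₁, e, conjDiagonal_mul, conjDiagonal_mul, conjDiagonal_sub, det_conjDiagonal,
    det_conjDiagonal, ← Finset.prod_mul_distrib]
  refine Finset.prod_congr rfl fun j _ => ?_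
  have := ha j
  simp only [Pi.sub_apply, Pi.mul_apply, Pi.inv_apply]
  field_simp

/-- Multiplication by `W*`, with `W` the eigenvector matrix, decouples the system into scalar
equations, one for each entry. -/
theorem Matrix.IsHermitian.eq_conjDiagonal_of_hasDerivAt {S : ℝ → Matrix m m ℂ} {c : ℂ}
    (hS : ∀ s j k, HasDerivAt (fun s => S s j k) (-(H * S s) j k + c * (1 : Matrix m m ℂ) j k) s) (s : ℝ) :
    S s = hH.conjDiagonal (fun j => (Real.exp (-(hH.eigenvalues j * s)) : ℂ)) * S 0 +
      hH.conjDiagonal (fun j => c * expIntegral (hH.eigenvalues j) s) := by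
  set W := (hH.eigenvectorUnitary : Matrix m m ℂ) with hW
  have h1 : star W * W = 1 := Unitary.coe_star_mul_self _
  have h2 : W * star W = 1 := Unitary.coe_mul_star_self _
  have h3 : star W * H = Matrix.diagonal (fun j => (hH.eigenvalues j : ℂ)) * star W := by
    conv_lhs => rw [← hH.conjDiagonal_eigenvalues]
    rw [conjDiagonal, ← hW, ← Matrix.mul_assoc, ← Matrix.mul_assoc, h1, Matrix.one_mul]
  have h4 : ∀ j k s, HasDerivAt (fun s => (star W * S s) j k)
      (-(hH.eigenvalues j * (star W * S s) j k) + c * star W j k) s := fun j k s => by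
    have h5 : HasDerivAt (fun s => ∑ l, star W j l * S s l k)
        (∑ l, star W j l * (-(H * S s) l k + c * (1 : Matrix m m ℂ) l k)) s :=
      HasDerivAt.fun_sum fun l _ => (hS s l k).const_mul _
    simp only [Matrix.mul_apply (M := star W)]
    refine h5.congr_deriv ?_
    have h6 : ∑ l, star W j l * (H * S s) l k = hH.eigenvalues j * ∑ l, star W j l * S s l k := by
      rw [← Matrix.mul_apply, ← Matrix.mul_apply, ← Matrix.mul_assoc, h3, Matrix.mul_assoc, Matrix.diagonal_mul]
    simp only [mul_add, Finset.sum_add_distrib, mul_neg, Finset.sum_neg_distrib, h6]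
    congr 1
    simp [Matrix.one_apply, mul_comm]
  have h7 : star W * S s = Matrix.diagonal (fun j => (Real.exp (-(hH.eigenvalues j * s)) : ℂ)) * (star W * S 0) +
      Matrix.diagonal (fun j => c * (expIntegral (hH.eigenvalues j) s : ℂ)) * star W := by
    ext j k
    have := eq_of_hasDerivAt_linear (h4 j k) s
    rw [this, Matrix.add_apply, Matrix.diagonal_mul, Matrix.diagonal_mul]
    ring
  calc S s = W * (star W * S s) := by rw [← Matrix.mul_assoc, h2, Matrix.one_mul]
    _ = _ := by
      rw [h7, Matrix.mul_add]
      simp only [conjDiagonal, ← hW, Matrix.mul_assoc]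

/-- The diagonal entries are real because `H` is Hermitian and imaginary by hypothesis, so the trace
vanishes. -/
theorem Matrix.IsHermitian.sum_eigenvalues_eq_zero_of_map_conj (hc : H.map (starRingEnd ℂ) = -H) :
    ∑ j, hH.eigenvalues j = 0 := by
  have h1 := hH.trace_eq_sum_eigenvalues
  have h2 : H.trace = 0 := by
    refine Finset.sum_eq_zero fun j _ => ?_
    have e1 := congrFun (congrFun hc j) j
    have e2 := congrFun (congrFun hH j) j
    simp only [Matrix.map_apply, Matrix.neg_apply, Matrix.conjTranspose_apply] at e1 e2
    have e3 : H j j = -H j j := e2.symm.trans e1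
    simpa using self_eq_neg.1 e3
  rw [h2] at h1
  exact Complex.ofReal_injective (by simpa using h1.symm)

include hH in
-- Since `H` and `c` change sign under conjugation, `s ↦ conj S(-s)` solves the same initial value
-- problem as `S`.
theorem Matrix.IsHermitian.map_conj_eq_of_hasDerivAt (hc : H.map (starRingEnd ℂ) = -H) {S : ℝ → Matrix m m ℂ} {c : ℂ}
    (hS : ∀ s j k, HasDerivAt (fun s => S s j k) (-(H * S s) j k + c * (1 : Matrix m m ℂ) j k) s)
    (h0 : (S 0).map (starRingEnd ℂ) = S 0) (hcc : starRingEnd ℂ c = -c)  (s : ℝ) :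
    (S s).map (starRingEnd ℂ) = S (-s) := by
  have h1 : ∀ s j k, HasDerivAt (fun s => (S (-s)).map (starRingEnd ℂ) j k)
      (-(H * (S (-s)).map (starRingEnd ℂ)) j k + c * (1 : Matrix m m ℂ) j k) s := fun s j k => by
    have h2 := ((hS (-s) j k).scomp s (hasDerivAt_neg s)).star
    refine h2.congr_deriv ?_
    have h3 : starRingEnd ℂ ((H * S (-s)) j k) = - (H * (S (-s)).map (starRingEnd ℂ)) j k := by
      have := congrFun (congrFun (Matrix.map_mul (L := H) (M := S (-s)) (f := starRingEnd ℂ)) j) k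
      rw [Matrix.map_apply, hc, Matrix.neg_mul] at this
      exact this
    have h4 : starRingEnd ℂ ((1 : Matrix m m ℂ) j k) = (1 : Matrix m m ℂ) j k := by
      rw [Matrix.one_apply]; split_ifs <;> simp
    simp only [neg_smul, one_smul, ← starRingEnd_apply, map_neg, map_add, map_mul, h3, h4, hcc]
    ring
  have h5 := hH.eq_conjDiagonal_of_hasDerivAt h1 (-s)
  rw [neg_neg, neg_zero, h0, ← hH.eq_conjDiagonal_of_hasDerivAt hS] at h5
  exact h5

/-- For each eigenvalue `l` the `2 × 2` determinant is `i (e^{ls} ψ_l(s') - e^{-ls'} ψ_l(-s)) = i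
e^{ls} ψ_l(s + s')`. The second conclusion serves measurability: it expresses the product through a
matrix that varies continuously with `Y`. -/
theorem Matrix.IsHermitian.det_fromBlocks_of_hasDerivAt (hc : H.map (starRingEnd ℂ) = -H) {P Q : ℝ → Matrix m m ℂ}
    (hP : ∀ s j k, HasDerivAt (fun s => P s j k) (-(H * P s) j k) s) (hP0 : P 0 = 1)
    (hQ : ∀ s j k, HasDerivAt (fun s => Q s j k)
      (-(H * Q s) j k + Complex.I * (1 : Matrix m m ℂ) j k) s) (hQ0 : Q 0 = 0) (s s' : ℝ) :
    (Matrix.fromBlocks ((P s).map (starRingEnd ℂ)) ((Q s).map (starRingEnd ℂ)) (P s') (Q s')).det =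
      Complex.I ^ Fintype.card m * ∏ j, (expIntegral (hH.eigenvalues j) (s + s') : ℂ) ∧
    (Q (s + s')).det = Complex.I ^ Fintype.card m * ∏ j, (expIntegral (hH.eigenvalues j) (s + s') : ℂ) := by
  have hP' : ∀ s j k, HasDerivAt (fun s => P s j k) (-(H * P s) j k + 0 * (1 : Matrix m m ℂ) j k) s := by
    simpa using hP
  have e1 : ∀ s, P s = hH.conjDiagonal (fun j => (Real.exp (-(hH.eigenvalues j * s)) : ℂ)) := fun s => by
    rw [hH.eq_conjDiagonal_of_hasDerivAt hP' s, hP0, Matrix.mul_one]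
    simp [conjDiagonal]
  have e2 : ∀ s, Q s = hH.conjDiagonal (fun j => Complex.I * (expIntegral (hH.eigenvalues j) s : ℂ)) := fun s => by
    rw [hH.eq_conjDiagonal_of_hasDerivAt hQ s, hQ0, Matrix.mul_zero, zero_add]
  have c1 := hH.map_conj_eq_of_hasDerivAt hc hP' (by simp [hP0]) (by simp) s
  have c2 := hH.map_conj_eq_of_hasDerivAt hc hQ (by simp [hQ0]) (by simp) s
  -- The eigenvalues sum to zero, so the factors `e^{ls}` disappear and only `s + s'` remains.
  have h0 : ∏ j, (Real.exp (hH.eigenvalues j * s) : ℂ) = 1 := by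
    rw [← Complex.ofReal_prod, ← Real.exp_sum, ← Finset.sum_mul, hH.sum_eigenvalues_eq_zero_of_map_conj hc]
    simp
  constructor
  · rw [c1, c2, e1, e1, e2, e2, hH.det_fromBlocks_conjDiagonal _ _ _ _ (fun j => by simp)]
    calc _ = ∏ j, (Complex.I * (Real.exp (hH.eigenvalues j * s) : ℂ)) * (expIntegral (hH.eigenvalues j) (s + s') : ℂ) := by
          refine Finset.prod_congr rfl fun j _ => ?_
          have a1 := congrArg Complex.ofReal (expIntegral_add (hH.eigenvalues j) s' s)
          -- As `ψ_l(0) = 0`, this gives `ψ_l(-s) = -e^{ls} ψ_l(s)`.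
          have a2 := congrArg Complex.ofReal (expIntegral_add (hH.eigenvalues j) (-s) s)
          rw [neg_add_cancel, expIntegral_zero] at a2
          rw [show hH.eigenvalues j * s = -(hH.eigenvalues j * -s) by ring, add_comm s s']
          simp only [Complex.ofReal_add, Complex.ofReal_mul, Complex.ofReal_zero] at a1 a2
          linear_combination (-Complex.I * (Real.exp (-(hH.eigenvalues j * -s)) : ℂ)) * a1 +
            Complex.I * (Real.exp (-(hH.eigenvalues j * s')) : ℂ) * a2
      _ = _ := by
        rw [Finset.prod_mul_distrib, Finset.prod_mul_distrib, h0]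
        simp
  · rw [e2, hH.det_conjDiagonal, Finset.prod_mul_distrib]
    simp

end
end MatrixODE

/-! ### The top power of a 2-form on a frame with one isotropic half. -/

section Pfaffian

theorem prod_range_two_mul_parity (n : ℕ) :
    (∏ a ∈ Finset.range (2 * n), if a % 2 = 1 then (-1 : ℤˣ) else 1) = (-1) ^ n := by
  induction n with
  | zero => simp
  | succ n ih =>
    rw [mul_add, mul_one, Finset.prod_range_succ, Finset.prod_range_succ, ih, if_neg (by omega), if_pos (by omega),
      pow_succ, mul_one]

theorem prod_range_two_mul_even (n : ℕ) :
    (∏ b ∈ Finset.range (2 * n), if b % 2 = 0 then (-1 : ℤˣ) ^ (b / 2) else 1) = (-1) ^ (n * (n - 1) / 2) := by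
  rw [← Finset.sum_range_id]
  induction n with
  | zero => simp
  | succ n ih =>
    rw [mul_add, mul_one, Finset.prod_range_succ, Finset.prod_range_succ, ih, if_pos (by omega), if_neg (by omega),
      Finset.sum_range_succ, pow_add, mul_one, Nat.mul_div_cancel_left _ two_pos]

/-- Even positions go to the first half and odd ones to the second, both in order. The inversions
are the pairs of an odd `i` below an even `j`, so `j` contributes `j / 2` of them and the total is
`0 + 1 + ⋯ + (n - 1)`. -/
theorem sign_shuffle {n : ℕ} (σ : Equiv.Perm (Fin (n + n)))
    (hσ : ∀ k, (σ k : ℕ) = (k : ℕ) / 2 + n * ((k : ℕ) % 2)) :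
    Equiv.Perm.sign σ = (-1) ^ (n * (n - 1) / 2) := by
  rw [Equiv.Perm.sign_eq_prod_prod_Iio, ← prod_range_two_mul_even n, two_mul,
    ← Fin.prod_univ_eq_prod_range (fun b => if b % 2 = 0 then (-1 : ℤˣ) ^ (b / 2) else 1)]
  refine Finset.prod_congr rfl fun j _ => ?_
  have h1 : ∏ i ∈ Finset.Iio j, (if σ i < σ j then (1 : ℤˣ) else -1) =
      ∏ a ∈ Finset.range j, if a % 2 = 1 ∧ (j : ℕ) % 2 = 0 then (-1 : ℤˣ) else 1 := by
    refine Finset.prod_bij (fun i _ => (i : ℕ)) (fun i hi => ?_) (fun _ _ _ _ h => Fin.ext h) (fun b hb => ?_) (fun i hi => ?_)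
    · simpa using hi
    · have hb' := Finset.mem_range.1 hb
      exact ⟨⟨b, by omega⟩, by simpa [Fin.lt_def] using hb', rfl⟩
    · have hi' : (i : ℕ) < j := by simpa using hi
      have hj := j.2
      simp only [Fin.lt_def, hσ]
      rcases Nat.mod_two_eq_zero_or_one i with h | h <;> rcases Nat.mod_two_eq_zero_or_one j with h' | h' <;>
        simp only [h, h', mul_zero, mul_one, add_zero] <;> split_ifs <;> first | rfl | omega | simp_all
  rw [h1]
  split_ifs with h
  · simp only [h, and_true]
    conv_lhs => rw [show (j : ℕ) = 2 * ((j : ℕ) / 2) by omega]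
    exact prod_range_two_mul_parity _
  · simp [h]

variable {n : ℕ}

/-- The permutation of `Fin n × Fin 2` given by a permutation of the pairs and a permutation of
each pair. -/
def pairPerm (g : Equiv.Perm (Fin n) × (Fin n → Equiv.Perm (Fin 2))) : Equiv.Perm (Fin n × Fin 2) :=
  (Equiv.prodCongrRight g.2).trans (Equiv.prodCongrLeft fun _ => g.1)

theorem pairPerm_apply (g : Equiv.Perm (Fin n) × (Fin n → Equiv.Perm (Fin 2))) (a : Fin n × Fin 2) :
    pairPerm g a = (g.1 a.1, g.2 a.1 a.2) := rfl

theorem pairPerm_injective : Function.Injective (pairPerm (n := n)) := by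
  intro g g' h
  have h1 : ∀ a, pairPerm g a = pairPerm g' a := fun a => by rw [h]
  simp only [pairPerm_apply, Prod.mk.injEq] at h1
  refine Prod.ext (Equiv.ext fun i => (h1 (i, 0)).1) (funext fun i => Equiv.ext fun b => (h1 (i, b)).2)

theorem sign_pairPerm (g : Equiv.Perm (Fin n) × (Fin n → Equiv.Perm (Fin 2))) :
    Equiv.Perm.sign (pairPerm g) = ∏ i, Equiv.Perm.sign (g.2 i) := by
  rw [pairPerm, Equiv.Perm.sign_trans, Equiv.Perm.sign_prodCongrRight, Equiv.Perm.sign_prodCongrLeft]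
  simp

theorem exists_pairPerm_of_fst_eq (ρ : Equiv.Perm (Fin n × Fin 2)) (h1 : ∀ i, (ρ (i, 0)).1 = (ρ (i, 1)).1)
    (h2 : ∀ i, (ρ (i, 0)).2 ≠ (ρ (i, 1)).2) : ∃ g, pairPerm g = ρ := by
  have h3 : ∀ i b, (ρ (i, b)).1 = (ρ (i, 0)).1 := fun i b => by
    fin_cases b
    · rfl
    · exact (h1 i).symm
  have hσ : Function.Injective fun i => (ρ (i, 0)).1 := by
    intro i i' h
    dsimp only at h
    have h4 : (ρ (i', 0)).2 = (ρ (i, 0)).2 ∨ (ρ (i', 0)).2 = (ρ (i, 1)).2 := by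
      have := h2 i
      omega
    rcases h4 with h4 | h4
    · have := ρ.injective (Prod.ext h.symm h4)
      exact (Prod.ext_iff.1 this).1.symm
    · have := ρ.injective (Prod.ext (h.symm.trans (h1 i)) h4)
      exact (Prod.ext_iff.1 this).1.symm
  have hε : ∀ i, Function.Injective fun b => (ρ (i, b)).2 := by
    intro i b b' h
    exact (Prod.ext_iff.1 (ρ.injective (Prod.ext ((h3 i b).trans (h3 i b').symm) h))).2
  refine ⟨(Equiv.ofBijective _ (Finite.injective_iff_bijective.1 hσ),
    fun i => Equiv.ofBijective _ (Finite.injective_iff_bijective.1 (hε i))), Equiv.ext fun a => ?_⟩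
  rw [pairPerm_apply]
  exact Prod.ext (h3 a.1 a.2).symm rfl

/-- The labels `1` number `n` in all and each of the `n` pairs receives at most one, so each
receives exactly one. -/
theorem snd_ne_of_not_both_one (ρ : Equiv.Perm (Fin n × Fin 2))
    (h : ∀ i, ¬ ((ρ (i, 0)).2 = 1 ∧ (ρ (i, 1)).2 = 1)) (i : Fin n) : (ρ (i, 0)).2 ≠ (ρ (i, 1)).2 := by
  have h1 : ∑ i, (((ρ (i, 0)).2 : ℕ) + ((ρ (i, 1)).2 : ℕ)) = ∑ i : Fin n, 1 := by
    have h2 : ∑ a : Fin n × Fin 2, ((ρ a).2 : ℕ) = ∑ a : Fin n × Fin 2, (a.2 : ℕ) :=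
      Equiv.sum_comp ρ fun a => (a.2 : ℕ)
    simpa [Fintype.sum_prod_type] using h2
  have h3 : ∀ i, ((ρ (i, 0)).2 : ℕ) + ((ρ (i, 1)).2 : ℕ) ≤ 1 := fun i => by
    have := h i
    omega
  have h4 := (Finset.sum_eq_sum_iff_of_le fun i _ => h3 i).1 h1 i (Finset.mem_univ i)
  omega

/-- Only permutations preserving the partition into pairs contribute. Swapping inside a pair changes
both the sign and the factor `M`, so each of the `2ⁿ n!` terms is `1`. Nothing is assumed about `M
(i, 0) (j, 0)`: by counting, such a factor would force a vanishing factor of type `(1, 1)`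
elsewhere. -/
theorem sum_sign_mul_prod_pairs (M : Fin n × Fin 2 → Fin n × Fin 2 → ℝ)
    (h11 : ∀ i j, M (i, 1) (j, 1) = 0) (h01 : ∀ i j, M (i, 0) (j, 1) = if i = j then 1 else 0)
    (h10 : ∀ i j, M (i, 1) (j, 0) = if i = j then -1 else 0) :
    ∑ ρ : Equiv.Perm (Fin n × Fin 2), ((Equiv.Perm.sign ρ : ℤ) : ℝ) * ∏ i, M (ρ (i, 0)) (ρ (i, 1)) =
      2 ^ n * n.factorial := by
  have h : ∑ g : Equiv.Perm (Fin n) × (Fin n → Equiv.Perm (Fin 2)), (1 : ℝ) =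
      ∑ ρ : Equiv.Perm (Fin n × Fin 2), ((Equiv.Perm.sign ρ : ℤ) : ℝ) * ∏ i, M (ρ (i, 0)) (ρ (i, 1)) := by
    refine Finset.sum_of_injOn pairPerm pairPerm_injective.injOn (fun _ _ => Finset.mem_univ _) ?_ ?_
    · intro ρ _ hρ
      by_contra hne
      apply hρ
      have hM : ∀ i, M (ρ (i, 0)) (ρ (i, 1)) ≠ 0 := fun i =>
        Finset.prod_ne_zero_iff.1 (right_ne_zero_of_mul hne) i (Finset.mem_univ i)
      have h2 := snd_ne_of_not_both_one ρ fun i hi => hM i (by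
        rw [← Prod.mk.eta (p := ρ (i, 0)), ← Prod.mk.eta (p := ρ (i, 1)), hi.1, hi.2, h11])
      have h1 : ∀ i, (ρ (i, 0)).1 = (ρ (i, 1)).1 := fun i => by
        by_contra hi
        apply hM i
        have := h2 i
        rw [← Prod.mk.eta (p := ρ (i, 0)), ← Prod.mk.eta (p := ρ (i, 1))]
        have h3 : ((ρ (i, 0)).2 = 0 ∧ (ρ (i, 1)).2 = 1) ∨ ((ρ (i, 0)).2 = 1 ∧ (ρ (i, 1)).2 = 0) := by omega
        rcases h3 with ⟨h3, h4⟩ | ⟨h3, h4⟩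
        · rw [h3, h4, h01, if_neg hi]
        · rw [h3, h4, h10, if_neg hi]
      obtain ⟨g, hg⟩ := exists_pairPerm_of_fst_eq ρ h1 h2
      exact ⟨g, by simp, hg⟩
    · intro g _
      rw [sign_pairPerm]
      push_cast
      rw [← Finset.prod_mul_distrib]
      refine (Finset.prod_eq_one fun i _ => ?_).symm
      rw [pairPerm_apply, pairPerm_apply]
      have h2 : ∀ e : Equiv.Perm (Fin 2), e = 1 ∨ e = Equiv.swap 0 1 := by decide
      rcases h2 (g.2 i) with h | h
      · simp [h, h01]
      · simp [h, h10]
  rw [← h]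
  simp [Fintype.card_perm, mul_comm]

theorem wedgePowTwoForm_eq_of_isotropic {W : Type*} (β : W → W → ℝ) (v : Fin (n + n) → W)
    (h11 : ∀ i j, β (v (Fin.natAdd n i)) (v (Fin.natAdd n j)) = 0)
    (h01 : ∀ i j, β (v (Fin.castAdd n i)) (v (Fin.natAdd n j)) = if i = j then 1 else 0)
    (h10 : ∀ i j, β (v (Fin.natAdd n i)) (v (Fin.castAdd n j)) = if i = j then -1 else 0) :
    wedgePowTwoForm β v = (-1) ^ (n * (n - 1) / 2) := by
  -- `e₁` lists the pairs consecutively, as in the product defining the power; `e₂` lists the two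
  -- halves one after the other, as in the frame. Their discrepancy is the shuffle, whose sign is
  -- the answer.
  let e₁ : Fin n × Fin 2 ≃ Fin (n + n) := finProdFinEquiv.trans (finCongr (by ring))
  let e₂ : Fin n × Fin 2 ≃ Fin (n + n) :=
    (Equiv.prodComm _ _).trans (finProdFinEquiv.trans (finCongr (by ring)))
  have he₁ : ∀ i b, (e₁ (i, b) : ℕ) = b + 2 * i := fun i b => rfl
  have he₂ : ∀ i b, (e₂ (i, b) : ℕ) = i + n * b := fun i b => rfl
  have h20 : ∀ i, e₂ (i, 0) = Fin.castAdd n i := fun i => Fin.ext (by simp [he₂])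
  have h21 : ∀ i, e₂ (i, 1) = Fin.natAdd n i := fun i => Fin.ext (by simp [he₂]; try ring)
  have hs : Equiv.Perm.sign (e₁.symm.trans e₂) = (-1) ^ (n * (n - 1) / 2) := by
    refine sign_shuffle _ fun k => ?_
    obtain ⟨⟨i, b⟩, rfl⟩ := e₁.surjective k
    have hb := b.2
    rw [Equiv.trans_apply, Equiv.symm_apply_apply, he₂, he₁]
    congr 2
    · omega
    · omega
  have h := sum_sign_mul_prod_pairs (fun a b => β (v (e₂ a)) (v (e₂ b)))
    (fun i j => by simp only [h21, h11]) (fun i j => by simp only [h20, h21, h01])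
    (fun i j => by simp only [h20, h21, h10])
  have h' : ∑ π : Equiv.Perm (Fin (n + n)), ((Equiv.Perm.sign π : ℤ) : ℝ) *
      ∏ i : Fin n, β (v (π ⟨2 * i, by omega⟩)) (v (π ⟨2 * i + 1, by omega⟩)) =
      (-1) ^ (n * (n - 1) / 2) * (2 ^ n * n.factorial) := by
    rw [← h, ← Equiv.sum_comp (Equiv.equivCongr e₁ e₂), Finset.mul_sum]
    refine Finset.sum_congr rfl fun ρ _ => ?_
    rw [Equiv.Perm.sign_equivCongr, hs]
    push_cast
    have e : ∀ i : Fin n, Equiv.equivCongr e₁ e₂ ρ ⟨2 * i, by omega⟩ = e₂ (ρ (i, 0)) ∧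
        Equiv.equivCongr e₁ e₂ ρ ⟨2 * i + 1, by omega⟩ = e₂ (ρ (i, 1)) := fun i => by
      have a0 : (⟨2 * i, by omega⟩ : Fin (n + n)) = e₁ (i, 0) := Fin.ext (by simp [he₁])
      have a1 : (⟨2 * i + 1, by omega⟩ : Fin (n + n)) = e₁ (i, 1) := Fin.ext (by simp [he₁, add_comm])
      rw [a0, a1]
      simp
    simp only [(e _).1, (e _).2]
    ring
  rw [wedgePowTwoForm, h']
  have : (n.factorial : ℝ) ≠ 0 := by positivity
  field_simp

end Pfaffian

/-! ### The symplectic and Liouville forms on the left-invariant frame. -/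

section Liouville

variable {E : Type*} [NormedAddCommGroup E] [NormedSpace ℝ E]
  {K : Type*} [TopologicalSpace K] [ChartedSpace E K]
  {n : ℕ}

theorem extChartAt_modelT_symm_apply (p : K × E) (z : E × E) :
    (extChartAt (modelT E) p).symm z = ((extChartAt 𝓘(ℝ, E) p.1).symm z.1, z.2) := by
  rw [extChartAt_prod]; simp [chartAt_self_eq]

theorem extChartAt_modelT_apply_self (p : K × E) :
    extChartAt (modelT E) p p = (extChartAt 𝓘(ℝ, E) p.1 p.1, p.2) := by
  rw [extChartAt_prod]; simp [chartAt_self_eq]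

variable [Group K] [LieGroup 𝓘(ℝ, E) ∞ K]

theorem contMDiffAt_extChartAt_symm (x : K) {z : E} (hz : z ∈ (extChartAt 𝓘(ℝ, E) x).target) :
    ContMDiffAt 𝓘(ℝ, E) 𝓘(ℝ, E) ∞ (extChartAt 𝓘(ℝ, E) x).symm z :=
  (contMDiffOn_extChartAt_symm x).contMDiffAt ((isOpen_extChartAt_target x).mem_nhds hz)

/-- This puts `θ` in coordinates through the logarithmic derivative of the inverse chart, whose
regularity is already known. -/
theorem leftTriv_comp_mfderiv_extChartAt_symm (p : K × E) {z : E × E}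
    (hz : z ∈ (extChartAt (modelT E) p).target) (v : E × E) :
    (leftTriv ((extChartAt (modelT E) p).symm z).1
      (mfderiv 𝓘(ℝ, E × E) (modelT E) (extChartAt (modelT E) p).symm z v).1 : E) =
      leftLogDeriv ℝ E (extChartAt 𝓘(ℝ, E) p.1).symm z.1 v.1 := by
  have hz1 : z.1 ∈ (extChartAt 𝓘(ℝ, E) p.1).target := by
    rw [extChartAt_prod] at hz
    exact hz.1
  have h1 : MDifferentiableAt 𝓘(ℝ, E × E) (modelT E) (extChartAt (modelT E) p).symm z :=
    ((contMDiffOn_extChartAt_symm (n := 1) p).contMDiffAt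
      ((isOpen_extChartAt_target p).mem_nhds hz)).mdifferentiableAt (by simp)
  have h2 := ((mdifferentiableAt_mul_left_const (F := E) ((extChartAt (modelT E) p).symm z).1⁻¹
    ((extChartAt (modelT E) p).symm z).1).hasMFDerivAt.comp ((extChartAt (modelT E) p).symm z)
      (hasMFDerivAt_fst _)).comp z h1.hasMFDerivAt
  have h3 : MDifferentiableAt 𝓘(ℝ, E) 𝓘(ℝ, E) (fun y => ((extChartAt 𝓘(ℝ, E) p.1).symm z.1)⁻¹ *
      (extChartAt 𝓘(ℝ, E) p.1).symm y) z.1 :=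
    (contMDiffAt_const.mul (contMDiffAt_extChartAt_symm p.1 hz1)).mdifferentiableAt (n := ∞) (by simp)
  have h4 : HasMFDerivAt 𝓘(ℝ, E × E) 𝓘(ℝ, E) (fun y : E × E => y.1) z (ContinuousLinearMap.fst ℝ E E) :=
    (ContinuousLinearMap.fst ℝ E E).hasFDerivAt.hasMFDerivAt
  have h5 := HasMFDerivAt.comp (f := fun y : E × E => y.1) z h3.hasMFDerivAt h4
  have h6 := h5.congr_of_eventuallyEq (f₁ := fun y =>
    ((extChartAt (modelT E) p).symm z).1⁻¹ * ((extChartAt (modelT E) p).symm y).1)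
    (Filter.Eventually.of_forall fun y => by
    simp only [extChartAt_modelT_symm_apply, Function.comp])
  exact DFunLike.congr_fun (hasMFDerivAt_unique h2 h6) v

theorem thetaForm_comp_mfderiv_apply [FiniteDimensional ℝ E] (X : Module.Basis (Fin n) ℝ E) (p : K × E) {z : E × E}
    (hz : z ∈ (extChartAt (modelT E) p).target) (v : E × E) :
    ((thetaForm (K := K) X ((extChartAt (modelT E) p).symm z)).comp
      (mfderiv 𝓘(ℝ, E × E) (modelT E) (extChartAt (modelT E) p).symm z) : E × E →L[ℝ] ℝ) v =
      ∑ i, X.repr z.2 i * X.repr (leftLogDeriv ℝ E (extChartAt 𝓘(ℝ, E) p.1).symm z.1 v.1) i := by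
  have h : (thetaForm (K := K) X ((extChartAt (modelT E) p).symm z)
      (mfderiv 𝓘(ℝ, E × E) (modelT E) (extChartAt (modelT E) p).symm z v) : ℝ) =
      ∑ i, X.repr z.2 i * X.repr (leftTriv ((extChartAt (modelT E) p).symm z).1
      (mfderiv 𝓘(ℝ, E × E) (modelT E) (extChartAt (modelT E) p).symm z v).1 : E) i := by
    have e : ((extChartAt (modelT E) p).symm z).2 = z.2 := by rw [extChartAt_modelT_symm_apply]
    rw [thetaForm, sum_apply]
    refine Finset.sum_congr rfl fun i _ => ?_
    rw [e]
    rfl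
  rw [leftTriv_comp_mfderiv_extChartAt_symm p hz] at h
  exact h

theorem leftLogDeriv_extChartAt_symm (x : K) :
    leftLogDeriv ℝ E (extChartAt 𝓘(ℝ, E) x).symm (extChartAt 𝓘(ℝ, E) x x) =
      (leftTriv x : E →L[ℝ] E) := by
  set z := extChartAt 𝓘(ℝ, E) x x with hz
  have hx : (extChartAt 𝓘(ℝ, E) x).symm z = x := extChartAt_to_inv x
  have h0 : MDifferentiableAt 𝓘(ℝ, E) 𝓘(ℝ, E) (extChartAt 𝓘(ℝ, E) x).symm z :=
    (contMDiffAt_extChartAt_symm x (mem_extChartAt_target x)).mdifferentiableAt (n := ∞) (by simp)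
  have h1 : (mfderiv 𝓘(ℝ, E) 𝓘(ℝ, E) (extChartAt 𝓘(ℝ, E) x).symm z : E →L[ℝ] E) =
      ContinuousLinearMap.id ℝ E := by
    have h := mfderivWithin_range_extChartAt_symm (I := 𝓘(ℝ, E)) (x := x)
    rw [modelWithCornersSelf_coe, Set.range_id, mfderivWithin_univ] at h
    exact h
  have h2 := ((mdifferentiableAt_mul_left_const (F := E) x⁻¹
    ((extChartAt 𝓘(ℝ, E) x).symm z)).hasMFDerivAt.comp z h0.hasMFDerivAt).mfderiv
  have h3 : leftLogDeriv ℝ E (extChartAt 𝓘(ℝ, E) x).symm z =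
      ((mfderiv 𝓘(ℝ, E) 𝓘(ℝ, E) (fun y : K => x⁻¹ * y) ((extChartAt 𝓘(ℝ, E) x).symm z) : E →L[ℝ] E)).comp
        (mfderiv 𝓘(ℝ, E) 𝓘(ℝ, E) (extChartAt 𝓘(ℝ, E) x).symm z : E →L[ℝ] E) := by
    have e : leftLogDeriv ℝ E (extChartAt 𝓘(ℝ, E) x).symm z = mfderiv 𝓘(ℝ, E) 𝓘(ℝ, E)
        (fun y => ((extChartAt 𝓘(ℝ, E) x).symm z)⁻¹ * (extChartAt 𝓘(ℝ, E) x).symm y) z := rfl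
    rw [e, congrArg (fun w : K => w⁻¹) hx]
    exact h2
  rw [h3, h1]
  refine ContinuousLinearMap.ext fun v => ?_
  change (mfderiv 𝓘(ℝ, E) 𝓘(ℝ, E) (fun y : K => x⁻¹ * y) ((extChartAt 𝓘(ℝ, E) x).symm z)) v = _
  rw [hx]
  rfl

/-- The expression in coordinates of the canonical 1-form. -/
theorem fderiv_sum_repr_mul [FiniteDimensional ℝ E] (X : Module.Basis (Fin n) ℝ E) {κ : E → E →L[ℝ] E} {z : E × E}
    (hκ : DifferentiableAt ℝ κ z.1) (w a : E) :
    fderiv ℝ (fun z : E × E => ∑ i, X.repr z.2 i * X.repr (κ z.1 w) i) z (0, a) =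
      ∑ i, X.repr a i * X.repr (κ z.1 w) i := by
  let c : Fin n → E →L[ℝ] ℝ := fun i => LinearMap.toContinuousLinearMap (X.coord i)
  have h : ∀ i, HasFDerivAt (fun z : E × E => c i z.2 * c i (κ z.1 w))
      (c i z.2 • (((c i).comp (ContinuousLinearMap.apply ℝ E w)).comp ((fderiv ℝ κ z.1).comp (ContinuousLinearMap.fst ℝ E E))) +
        c i (κ z.1 w) • (c i).comp (ContinuousLinearMap.snd ℝ E E)) z := fun i => by
    refine HasFDerivAt.mul ((c i).comp (ContinuousLinearMap.snd ℝ E E)).hasFDerivAt ?_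
    exact ((c i).comp (ContinuousLinearMap.apply ℝ E w)).hasFDerivAt.comp z (hκ.hasFDerivAt.comp z hasFDerivAt_fst)
  have h2 := (HasFDerivAt.fun_sum (u := Finset.univ) fun i _ => h i).fderiv
  refine (DFunLike.congr_fun h2 (0, a)).trans ?_
  rw [sum_apply]
  refine Finset.sum_congr rfl fun i _ => ?_
  simp [c, mul_comm]

/-- `θ` vanishes on fibre vectors and is linear in `y`, so with one fibre argument `dθ` is just a
derivative in `y`. The bracket term of `dw`, which occurs for two `K`-directions, is never needed,
since `wedgePowTwoForm_eq_of_isotropic` ignores that block. -/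
theorem omegaForm_eq [FiniteDimensional ℝ E] (X : Module.Basis (Fin n) ℝ E) (p : K × E) (u : E × E) (a : E) :
    omegaForm X p u ((0, a) : E × E) = ∑ i, X.repr a i * X.repr (leftTriv p.1 u.1 : E) i ∧
    omegaForm X p ((0, a) : E × E) u = -∑ i, X.repr a i * X.repr (leftTriv p.1 u.1 : E) i := by
  set z₀ := extChartAt (modelT E) p p with hz₀
  let κ : E → E →L[ℝ] E := leftLogDeriv ℝ E (extChartAt 𝓘(ℝ, E) p.1).symm
  have hκ : DifferentiableAt ℝ κ z₀.1 := by
    refine (contDiffAt_leftLogDeriv (contMDiffAt_extChartAt_symm p.1 ?_)).differentiableAt (by simp)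
    rw [hz₀, extChartAt_modelT_apply_self]
    exact mem_extChartAt_target p.1
  have hκ₀ : κ z₀.1 = (leftTriv p.1 : E →L[ℝ] E) := by
    rw [hz₀, extChartAt_modelT_apply_self]
    exact leftLogDeriv_extChartAt_symm p.1
  let c : Fin n → E →L[ℝ] ℝ := fun i => LinearMap.toContinuousLinearMap (X.coord i)
  let α : E × E → (E × E →L[ℝ] ℝ) := fun z =>
    ∑ i, c i z.2 • (c i).comp ((κ z.1).comp (ContinuousLinearMap.fst ℝ E E))
  have hα : ∀ z v, α z v = ∑ i, X.repr z.2 i * X.repr (κ z.1 v.1) i := fun z v => by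
    simp [α, c, sum_apply]
  have hαd : DifferentiableAt ℝ α z₀ := by
    refine DifferentiableAt.fun_sum fun i _ => ?_
    refine DifferentiableAt.smul ((c i).differentiableAt.comp z₀ differentiableAt_snd) ?_
    have : DifferentiableAt ℝ (fun z : E × E => κ z.1) z₀ := hκ.comp z₀ differentiableAt_fst
    exact (differentiableAt_const _).clm_comp (this.clm_comp (differentiableAt_const _))
  have hext : ∀ u v : E × E, extDerivOneForm (modelT E) (thetaForm (K := K) X) p u v =
      fderiv ℝ (fun z => α z v) z₀ u - fderiv ℝ (fun z => α z u) z₀ v := fun u v => by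
    let β : E × E → (E × E) [⋀^Fin 1]→L[ℝ] ℝ := fun z =>
      ContinuousAlternatingMap.ofSubsingletonLIE (𝕜 := ℝ) (E := E × E) (F := ℝ) (0 : Fin 1) (α z)
    have hβ : DifferentiableAt ℝ β z₀ :=
      (ContinuousAlternatingMap.ofSubsingletonLIE (𝕜 := ℝ) (E := E × E) (F := ℝ)
        (0 : Fin 1)).toContinuousLinearEquiv.differentiableAt.comp z₀ hαd
    -- The coordinate formula is available only on the chart target, which suffices for a derivative
    -- at `z₀`.
    have he : (fun z : E × E => ContinuousAlternatingMap.ofSubsingleton ℝ (E × E) ℝ (0 : Fin 1)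
        ((thetaForm (K := K) X ((extChartAt (modelT E) p).symm z)).comp
          (mfderiv 𝓘(ℝ, E × E) (modelT E) (extChartAt (modelT E) p).symm z))) =ᶠ[nhds z₀] β := by
      filter_upwards [extChartAt_target_mem_nhds (I := modelT E) p] with z hz
      refine congrArg (ContinuousAlternatingMap.ofSubsingleton ℝ (E × E) ℝ (0 : Fin 1)) ?_
      refine ContinuousLinearMap.ext fun v => ?_
      rw [hα]
      exact thetaForm_comp_mfderiv_apply X p hz v
    refine (DFunLike.congr_fun he.extDeriv_eq ![u, v]).trans ?_
    rw [extDeriv_apply hβ, Fin.sum_univ_two]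
    simp [β, Fin.removeNth, sub_eq_add_neg]
  have h1 : ∀ v, fderiv ℝ (fun z => α z v) z₀ (0, a) = ∑ i, X.repr a i * X.repr (leftTriv p.1 v.1 : E) i := fun v => by
    simp only [hα]
    rw [fderiv_sum_repr_mul X hκ, hκ₀]
    rfl
  have h2 : ∀ u : E × E, fderiv ℝ (fun z => α z (0, a)) z₀ u = 0 := fun u => by
    simp [hα]
  constructor
  · refine (congrArg Neg.neg (hext u (0, a))).trans ?_
    rw [h1, h2, zero_sub, neg_neg]
  · refine (congrArg Neg.neg (hext (0, a) u)).trans ?_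
    rw [h1, h2, sub_zero]

theorem liouvilleForm_leftFrame [FiniteDimensional ℝ E] (X : Module.Basis (Fin n) ℝ E) (p : K × E) :
    liouvilleForm X p (leftFrame X p) = (-1) ^ (n * (n - 1) / 2) := by
  have h0 : ∀ i, leftFrame X p (Fin.natAdd n i) = (((0 : E), X i) : E × E) := fun i =>
    Fin.append_right _ _ _
  have h1 : ∀ i, leftFrame X p (Fin.castAdd n i) =
      ((mfderiv 𝓘(ℝ, E) 𝓘(ℝ, E) (fun y : K => p.1 * y) 1 (X i), (0 : E)) : E × E) := fun i =>
    Fin.append_left _ _ _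
  refine wedgePowTwoForm_eq_of_isotropic _ _ (fun i j => ?_) (fun i j => ?_) fun i j => ?_
  · refine (congrArg₂ (omegaForm X p) (h0 i) (h0 j)).trans ((omegaForm_eq X p _ _).1.trans ?_)
    have h : (leftTriv p.1 (0 : E) : E) = 0 := ContinuousLinearMap.map_zero _
    simp only [h]
    simp
  · refine (congrArg₂ (omegaForm X p) (h1 i) (h0 j)).trans ((omegaForm_eq X p _ _).1.trans ?_)
    simp only [leftTriv_mfderiv_mul_left]
    simp [Finsupp.single_apply, eq_comm]
  · refine (congrArg₂ (omegaForm X p) (h0 i) (h1 j)).trans ((omegaForm_eq X p _ _).2.trans ?_)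
    simp only [leftTriv_mfderiv_mul_left]
    simp only [X.repr_self, Finsupp.single_apply, ite_mul, one_mul, zero_mul, Finset.sum_ite_eq,
      Finset.mem_univ, if_true, eq_comm (a := j)]
    split_ifs <;> simp

end Liouville

/-! ### The function `(Ω̄_s ∧ Ω_{s'}) / (b ε)`. -/

section BKSRatio

variable {n : ℕ} {E : Type*} [NormedAddCommGroup E] [NormedSpace ℝ E] [FiniteDimensional ℝ E]
  {K : Type*} [TopologicalSpace K] [ChartedSpace E K] [Group K] [LieGroup 𝓘(ℝ, E) ∞ K]
  {F : Type*} [NormedAddCommGroup F] [NormedSpace ℂ F] [FiniteDimensional ℂ F]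
  {G : Type*} [TopologicalSpace G] [ChartedSpace F G] [Group G] [LieGroup 𝓘(ℂ, F) ∞ G]

omit [FiniteDimensional ℂ F] in
theorem PrequantumBKS.IsComplexification.bksRatio_eq {ι : K →* G} (hι : IsComplexification E F ι)
    (X : Module.Basis (Fin n) ℝ E) (s s' : ℝ) (p : K × E) :
    bksRatio F ι X s s' p =
      (Matrix.fromBlocks ((hι.adMatrix X p.2 s).map (starRingEnd ℂ))
        ((hι.imagExpMatrix X p.2 s).map (starRingEnd ℂ))
        (hι.adMatrix X p.2 s') (hι.imagExpMatrix X p.2 s')).det / (2 * Complex.I) ^ n := by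
  rw [bksRatio, hι.OmegaBarWedgeOmega_leftFrame, liouvilleForm_leftFrame, bConst]
  congr 1
  push_cast
  rw [mul_assoc, ← mul_pow]
  simp

/-- The function `(Ω̄_s ∧ Ω_{s'}) / (b ε)` depends on `s + s'` only, and is a product over the
eigenvalues of `i ad Y`. -/
theorem PrequantumBKS.IsComplexification.exists_bksRatio_eq_prod
    [MeasurableSpace E] [BorelSpace E] [MeasurableSpace K]
    {ι : K →* G} (hι : IsComplexification E F ι)
    (B : LinearMap.BilinForm ℝ E) (hB_symm : ∀ u v, B u v = B v u)
    (hB_Ad : ∀ (x : K) (u v : E), B (Ad x u) (Ad x v) = B u v)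
    (X : Module.Basis (Fin n) ℝ E) (hX : ∀ i j, B (X i) (X j) = if i = j then 1 else 0) :
    ∃ l : K × E → Fin n → ℝ,
      (∀ s s' p, bksRatio F ι X s s' p = ((∏ j, expIntegral (l p j) (s + s') / 2 : ℝ) : ℂ)) ∧
      ∀ r, Measurable fun p => ∏ j, expIntegral (l p j) r / 2 := by
  have hH := fun Y : E => imagAdMatrix_isHermitian B hB_Ad hB_symm X hX Y
  have key := fun (Y : E) (s s' : ℝ) => (hH Y).1.det_fromBlocks_of_hasDerivAt (hH Y).2
    (fun s j k => hι.hasDerivAt_adMatrix X Y s j k) (hι.adMatrix_zero X Y)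
    (fun s j k => hι.hasDerivAt_imagExpMatrix X Y s j k) (hι.imagExpMatrix_zero X Y) s s'
  have hdiv : ∀ (Y : E) (r : ℝ), (Complex.I ^ n * ∏ j, (expIntegral ((hH Y).1.eigenvalues j) r : ℂ)) /
      (2 * Complex.I) ^ n = ((∏ j, expIntegral ((hH Y).1.eigenvalues j) r / 2 : ℝ) : ℂ) := fun Y r => by
    have hI : Complex.I ^ n ≠ 0 := pow_ne_zero _ Complex.I_ne_zero
    rw [Finset.prod_div_distrib]
    simp only [Finset.prod_const, Finset.card_univ, Fintype.card_fin]
    push_cast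
    rw [mul_pow]
    field_simp
  simp only [Fintype.card_fin] at key
  refine ⟨fun p => (hH p.2).1.eigenvalues, fun s s' p => ?_, fun r => ?_⟩
  · rw [hι.bksRatio_eq, (key p.2 s s').1, ← hdiv]
  · have h : (fun p : K × E => ∏ j, expIntegral ((hH p.2).1.eigenvalues j) r / 2) =
        fun p => ((hι.imagExpMatrix X p.2 r).det / (2 * Complex.I) ^ n).re := by
      funext p
      have := (key p.2 r 0).2
      rw [add_zero] at this
      rw [this, hdiv, Complex.ofReal_re]
    rw [h]
    have hc : Continuous fun Y => hι.imagExpMatrix X Y r :=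
      continuous_matrix fun j k => hι.continuous_imagExpMatrix X r j k
    exact (Complex.continuous_re.comp (hc.matrix_det.div_const _)).measurable.comp measurable_snd

end BKSRatio

/-! ### Uniform bounds for the kernel of the pairing. -/

section Kernel

/-- This is the monotonicity of `sinh x / x`, proved by differentiating `θ sinh x - sinh (θ x)` with
`θ = a / b ≤ 1`. -/
theorem mul_sinh_le_mul_sinh {a b : ℝ} (ha : 0 ≤ a) (hab : a ≤ b) :
    b * Real.sinh a ≤ a * Real.sinh b := by
  rcases ha.eq_or_lt with rfl | ha'
  · simp
  have hb : 0 < b := ha'.trans_le hab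
  have hθ : a / b ≤ 1 := (div_le_one hb).2 hab
  have hθ0 : 0 ≤ a / b := by positivity
  have hd : ∀ x, HasDerivAt (fun x => a / b * Real.sinh x - Real.sinh (a / b * x))
      (a / b * Real.cosh x - Real.cosh (a / b * x) * (a / b)) x := fun x => by
    have h := ((hasDerivAt_id x).const_mul (a / b)).sinh
    simp only [mul_one, id] at h
    exact ((Real.hasDerivAt_sinh x).const_mul _).sub h
  have hmono : MonotoneOn (fun x => a / b * Real.sinh x - Real.sinh (a / b * x)) (Set.Ici 0) := by
    refine monotoneOn_of_deriv_nonneg (convex_Ici 0)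
      (fun x _ => (hd x).continuousAt.continuousWithinAt)
      (fun x _ => (hd x).differentiableAt.differentiableWithinAt) fun x hx => ?_
    rw [interior_Ici] at hx
    have hx' : (0 : ℝ) < x := hx
    rw [(hd x).deriv, mul_comm (Real.cosh _), ← mul_sub]
    refine mul_nonneg hθ0 (sub_nonneg.2 (Real.cosh_le_cosh.2 ?_))
    rw [abs_of_nonneg (by positivity), abs_of_pos hx']
    exact mul_le_of_le_one_left hx'.le hθ
  have h := hmono (Set.mem_Ici.2 le_rfl) (Set.mem_Ici.2 hb.le) hb.le
  simp only [mul_zero, Real.sinh_zero, sub_zero, div_mul_cancel₀ a hb.ne'] at h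
  rw [div_mul_eq_mul_div, sub_nonneg, le_div_iff₀ hb] at h
  linarith

theorem sq_mul_sinh_sq_le {d m : ℝ} (h : |d| ≤ m) :
    m ^ 2 * Real.sinh d ^ 2 ≤ d ^ 2 * Real.sinh m ^ 2 := by
  have h1 := mul_sinh_le_mul_sinh (abs_nonneg d) h
  have h2 : 0 ≤ Real.sinh |d| := Real.sinh_nonneg_iff.2 (abs_nonneg d)
  have h3 := mul_self_le_mul_self (mul_nonneg ((abs_nonneg d).trans h) h2) h1
  have h4 : Real.sinh |d| ^ 2 = Real.sinh d ^ 2 := by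
    rw [← Real.abs_sinh, sq_abs]
  have h5 := sq_abs d
  calc _ = (m * Real.sinh |d|) * (m * Real.sinh |d|) := by rw [← h4]; ring
    _ ≤ _ := h3
    _ = _ := by rw [← h5]; ring

theorem mul_expIntegral_eq_sinh (l r : ℝ) :
    l * expIntegral l (2 * r) = Real.exp (-(l * r)) * (2 * Real.sinh (l * r)) := by
  rw [mul_expIntegral, Real.sinh_eq, mul_div_cancel₀ _ two_ne_zero, mul_sub, ← Real.exp_add, ← Real.exp_add]
  congr 2
  · simp
  · ring_nf

theorem sinh_mul_sinh_eq (a b : ℝ) : Real.sinh (a + b) * Real.sinh (a - b) = Real.sinh a ^ 2 - Real.sinh b ^ 2 := by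
  rw [Real.sinh_add, Real.sinh_sub]
  have h1 := Real.cosh_sq a
  have h2 := Real.cosh_sq b
  linear_combination Real.sinh a ^ 2 * h2 - Real.sinh b ^ 2 * h1

/-- With `m = l(s+t)/2` and `d = l(s-t)/2` and `l ≠ 0`, the ratio `ψ(s+t)² / (ψ(2s) ψ(2t))` is
`sinh² m / (sinh² m - sinh² d)`. It is at least `1`, and `sinh² d / d² ≤ sinh² m / m²` bounds it by
`m² / (m² - d²) = (s+t)²/(4st)`, which is free of `l`. That independence makes the kernel estimate
uniform in `Y`. -/
theorem expIntegral_mul_le_sq_and_le (l : ℝ) {s t : ℝ} (hs : 0 < s) (ht : 0 < t) :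
    expIntegral l (2 * s) * expIntegral l (2 * t) ≤ expIntegral l (s + t) ^ 2 ∧
    expIntegral l (s + t) ^ 2 ≤
      (1 + (t - s) ^ 2 / (4 * s * t)) * (expIntegral l (2 * s) * expIntegral l (2 * t)) := by
  have hst : 1 + (t - s) ^ 2 / (4 * s * t) = (s + t) ^ 2 / (4 * s * t) := by
    field_simp
    ring
  rw [hst, div_mul_eq_mul_div, le_div_iff₀ (by positivity)]
  rcases eq_or_ne l 0 with rfl | hl
  · simp only [expIntegral, if_true]
    constructor <;> nlinarith [sq_nonneg (s - t)]
  set m := l * ((s + t) / 2) with hm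
  set d := l * ((s - t) / 2) with hd
  have e1 : l * expIntegral l (2 * s) = Real.exp (-(l * s)) * (2 * Real.sinh (m + d)) := by
    rw [mul_expIntegral_eq_sinh, hm, hd]; ring_nf
  have e2 : l * expIntegral l (2 * t) = Real.exp (-(l * t)) * (2 * Real.sinh (m - d)) := by
    rw [mul_expIntegral_eq_sinh, hm, hd]; ring_nf
  have e3 : l * expIntegral l (s + t) = Real.exp (-m) * (2 * Real.sinh m) := by
    rw [hm, ← mul_expIntegral_eq_sinh]; ring_nf
  have e4 : Real.exp (-m) * Real.exp (-m) = Real.exp (-(l * s)) * Real.exp (-(l * t)) := by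
    rw [← Real.exp_add, ← Real.exp_add, hm]; ring_nf
  have hl2 : 0 < l ^ 2 := by positivity
  set A := 4 * (Real.exp (-(l * s)) * Real.exp (-(l * t))) with hA
  have hA0 : 0 < A := by positivity
  have f1 : l ^ 2 * (expIntegral l (2 * s) * expIntegral l (2 * t)) = A * (Real.sinh m ^ 2 - Real.sinh d ^ 2) := by
    rw [← sinh_mul_sinh_eq, show l ^ 2 * (expIntegral l (2 * s) * expIntegral l (2 * t)) =
      (l * expIntegral l (2 * s)) * (l * expIntegral l (2 * t)) by ring, e1, e2, hA]
    ring
  have f2 : l ^ 2 * expIntegral l (s + t) ^ 2 = A * Real.sinh m ^ 2 := by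
    rw [← mul_pow, e3, hA, ← e4]
    ring
  -- `m` is negative when `l` is, so the bound is applied with `|l|` and carried back by evenness.
  have hdm : |(|l| * ((s - t) / 2))| ≤ |l| * ((s + t) / 2) := by
    rw [abs_mul, abs_abs]
    exact mul_le_mul_of_nonneg_left (abs_le.2 ⟨by linarith, by linarith⟩) (abs_nonneg l)
  have hsinh : m ^ 2 * Real.sinh d ^ 2 ≤ d ^ 2 * Real.sinh m ^ 2 := by
    have h := sq_mul_sinh_sq_le hdm
    rcases abs_cases l with ⟨h', -⟩ | ⟨h', -⟩ <;> rw [h'] at h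
    · exact h
    · simpa only [neg_mul, Real.sinh_neg, neg_sq] using h
  constructor
  · refine le_of_mul_le_mul_left ?_ hl2
    rw [f1, f2]
    exact mul_le_mul_of_nonneg_left (by nlinarith [sq_nonneg (Real.sinh d)]) hA0.le
  · refine le_of_mul_le_mul_left ?_ (mul_pos hl2 hl2)
    have g1 : l ^ 2 * l ^ 2 * (expIntegral l (s + t) ^ 2 * (4 * s * t)) = A * Real.sinh m ^ 2 * (4 * (m ^ 2 - d ^ 2)) := by
      rw [← f2, hm, hd]; ring
    have g2 : l ^ 2 * l ^ 2 * ((s + t) ^ 2 * (expIntegral l (2 * s) * expIntegral l (2 * t))) =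
        A * (Real.sinh m ^ 2 - Real.sinh d ^ 2) * (4 * m ^ 2) := by
      rw [← f1, hm]; ring
    rw [g1, g2]
    nlinarith

end Kernel

section Kernel

theorem one_le_bksKernel_and_le {n : ℕ} (l : Fin n → ℝ) {D : ℝ → ℝ}
    (hD : ∀ r, D r = ∏ j, expIntegral (l j) r / 2) {s t : ℝ} (hs : 0 < s) (ht : 0 < t) :
    1 ≤ √(D (s + t)) / (√(√(D (s + s))) * √(√(D (t + t)))) ∧
    √(D (s + t)) / (√(√(D (s + s))) * √(√(D (t + t)))) ≤ (1 + (t - s) ^ 2 / (4 * s * t)) ^ n := by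
  have hpos : ∀ r, 0 < r → 0 < D r := fun r hr => by
    rw [hD]
    exact Finset.prod_pos fun j _ => div_pos (expIntegral_pos (l j) hr) two_pos
  have h4 : ∀ x : ℝ, 0 ≤ x → √(√x) ^ 4 = x := fun x hx => by
    rw [show 4 = 2 * 2 from rfl, pow_mul, Real.sq_sqrt (Real.sqrt_nonneg x), Real.sq_sqrt hx]
  have h2 : √(D (s + t)) ^ 4 = D (s + t) ^ 2 := by
    rw [show 4 = 2 * 2 from rfl, pow_mul, Real.sq_sqrt (hpos _ (add_pos hs ht)).le]
  set R := √(D (s + t)) / (√(√(D (s + s))) * √(√(D (t + t)))) with hR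
  have hR0 : 0 ≤ R := by positivity
  have hM : 0 < D (s + s) * D (t + t) := mul_pos (hpos _ (by positivity)) (hpos _ (by positivity))
  have hR4 : R ^ 4 = D (s + t) ^ 2 / (D (s + s) * D (t + t)) := by
    rw [hR, div_pow, mul_pow, h2, h4 _ (hpos _ (by positivity)).le, h4 _ (hpos _ (by positivity)).le]
  have hj := fun j => expIntegral_mul_le_sq_and_le (l j) hs ht
  have hψ : ∀ j r, 0 < r → 0 < expIntegral (l j) r := fun j r hr => expIntegral_pos (l j) hr
  have hNM : D (s + s) * D (t + t) ≤ D (s + t) ^ 2 := by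
    rw [hD, hD, hD, ← Finset.prod_mul_distrib, ← Finset.prod_pow]
    refine Finset.prod_le_prod (fun j _ => ?_) fun j _ => ?_
    · have h1 := hψ j (s + s) (by positivity)
      have h2 := hψ j (t + t) (by positivity)
      positivity
    · have := (hj j).1
      rw [two_mul, two_mul] at this
      linarith
  have hNM' : D (s + t) ^ 2 ≤ (1 + (t - s) ^ 2 / (4 * s * t)) ^ n * (D (s + s) * D (t + t)) := by
    have hc : (1 + (t - s) ^ 2 / (4 * s * t)) ^ n = ∏ _j : Fin n, (1 + (t - s) ^ 2 / (4 * s * t)) := by simp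
    rw [hc, hD, hD, hD, ← Finset.prod_mul_distrib, ← Finset.prod_pow, ← Finset.prod_mul_distrib]
    refine Finset.prod_le_prod (fun j _ => sq_nonneg _) fun j _ => ?_
    have := (hj j).2
    rw [two_mul, two_mul] at this
    linarith
  have h1 : 1 ≤ R := by
    refine (one_le_pow_iff_of_nonneg hR0 (n := 4) (by norm_num)).1 ?_
    rw [hR4, one_le_div hM]
    exact hNM
  -- The fourth power clears all roots, and `R ≤ R⁴` because `1 ≤ R`; the lost exponent is harmless,
  -- as only second-order contact at `t = s` matters.
  refine ⟨h1, (le_self_pow₀ h1 (n := 4) (by norm_num)).trans ?_⟩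
  rw [hR4, div_le_iff₀ hM]
  exact hNM'

end Kernel

/-! ### `L²` spaces with a positive density. -/

section Weight

variable {Ω : Type*} [MeasurableSpace Ω] {μ : Measure Ω} {w : Ω → ℝ}

theorem ae_withDensity_ofReal_eq (hw : Measurable w) (hpos : ∀ x, 0 < w x) :
    ae (μ.withDensity fun x => ENNReal.ofReal (w x)) = ae μ := by
  refine le_antisymm (withDensity_absolutelyContinuous _ _).ae_le ?_
  refine (withDensity_absolutelyContinuous' hw.ennreal_ofReal.aemeasurable ?_).ae_le
  exact Filter.Eventually.of_forall fun x => (ENNReal.ofReal_pos.2 (hpos x)).ne'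

theorem memLp_withDensity_ofReal_iff (hw : Measurable w) (hpos : ∀ x, 0 < w x) {f : Ω → ℂ} :
    MemLp f 2 (μ.withDensity fun x => ENNReal.ofReal (w x)) ↔
      MemLp (fun x => (√(w x) : ℂ) * f x) 2 μ := by
  have hae := ae_withDensity_ofReal_eq (μ := μ) hw hpos
  have hac : (μ.withDensity fun x => ENNReal.ofReal (w x)) ≪ μ := withDensity_absolutelyContinuous _ _
  have hac' : μ ≪ (μ.withDensity fun x => ENNReal.ofReal (w x)) := Measure.ae_le_iff_absolutelyContinuous.1 hae.ge
  have hsq : Measurable fun x => (√(w x) : ℂ) := Complex.measurable_ofReal.comp hw.sqrt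
  have hne : ∀ x, (√(w x) : ℂ) ≠ 0 := fun x => by exact_mod_cast (Real.sqrt_pos.2 (hpos x)).ne'
  have hm : AEStronglyMeasurable f (μ.withDensity fun x => ENNReal.ofReal (w x)) ↔
      AEStronglyMeasurable (fun x => (√(w x) : ℂ) * f x) μ := by
    constructor
    · intro h
      exact hsq.aestronglyMeasurable.mul (h.mono_ac hac')
    · intro h
      refine ((hsq.inv.aestronglyMeasurable.mul h).congr (Filter.Eventually.of_forall fun x => ?_)).mono_ac hac
      simp only [Pi.mul_apply, Pi.inv_apply]
      rw [inv_mul_cancel_left₀ (hne x)]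
  have key : AEStronglyMeasurable f (μ.withDensity fun x => ENNReal.ofReal (w x)) →
      (MemLp f 2 (μ.withDensity fun x => ENNReal.ofReal (w x)) ↔
      MemLp (fun x => (√(w x) : ℂ) * f x) 2 μ) := fun h => by
    rw [memLp_two_iff_integrable_sq_norm h, memLp_two_iff_integrable_sq_norm (hm.1 h),
      integrable_withDensity_iff_integrable_smul' hw.ennreal_ofReal
        (Filter.Eventually.of_forall fun x => ENNReal.ofReal_lt_top)]
    refine integrable_congr (Filter.Eventually.of_forall fun x => ?_)
    simp only [ENNReal.toReal_ofReal (hpos x).le, smul_eq_mul, norm_mul, mul_pow, Complex.norm_real,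
      Real.norm_eq_abs, sq_abs, Real.sq_sqrt (hpos x).le]
  exact ⟨fun h => (key h.1).1 h, fun h => (key (hm.2 h.1)).2 h⟩

theorem inner_withDensity_ofReal_eq (hw : Measurable w) (hpos : ∀ x, 0 < w x) {f g : Lp ℂ 2 μ}
    {u v : Lp ℂ 2 (μ.withDensity fun x => ENNReal.ofReal (w x))}
    (hu : u =ᵐ[μ] fun x => f x / (√(w x) : ℂ)) (hv : v =ᵐ[μ] fun x => g x / (√(w x) : ℂ)) :
    inner ℂ u v = inner ℂ f g := by
  rw [L2.inner_def, L2.inner_def, integral_withDensity_eq_integral_toReal_smul hw.ennreal_ofReal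
    (Filter.Eventually.of_forall fun x => ENNReal.ofReal_lt_top)]
  refine integral_congr_ae ?_
  filter_upwards [hu, hv] with x hx hx'
  have hne : (√(w x) : ℂ) ≠ 0 := by exact_mod_cast (Real.sqrt_pos.2 (hpos x)).ne'
  have hsq : (w x : ℂ) = (√(w x) : ℂ) * (√(w x) : ℂ) := by
    exact_mod_cast (Real.mul_self_sqrt (hpos x).le).symm
  rw [hx, hx', ENNReal.toReal_ofReal (hpos x).le, Complex.real_smul, hsq]
  simp only [RCLike.inner_apply, map_div₀, Complex.conj_ofReal]
  field_simp

/-- Multiplication by a bounded function close to `1` is close to the identity of `L²`. -/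
theorem exists_lp_eq_mul {R : Ω → ℝ} (hR : Measurable R) {C : ℝ} (hC : ∀ x, |R x - 1| ≤ C) (f : Lp ℂ 2 μ) :
    ∃ h : Lp ℂ 2 μ, h =ᵐ[μ] (fun x => (R x : ℂ) * f x) ∧ ‖h - f‖ ≤ C * ‖f‖ := by
  have hRm : AEStronglyMeasurable (fun x => (R x : ℂ)) μ :=
    (Complex.measurable_ofReal.comp hR).aestronglyMeasurable
  have hm : MemLp (fun x => (R x : ℂ) * f x) 2 μ := by
    refine (Lp.memLp f).of_le_mul (c := 1 + C) (hRm.mul (Lp.aestronglyMeasurable f))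
      (Filter.Eventually.of_forall fun x => ?_)
    rw [norm_mul, Complex.norm_real, Real.norm_eq_abs]
    refine mul_le_mul_of_nonneg_right ?_ (norm_nonneg _)
    have := abs_add_le 1 (R x - 1)
    rw [add_sub_cancel, abs_one] at this
    linarith [hC x]
  refine ⟨hm.toLp, hm.coeFn_toLp, Lp.norm_le_mul_norm_of_ae_le_mul ?_⟩
  filter_upwards [hm.coeFn_toLp, Lp.coeFn_sub hm.toLp f] with x hx hx'
  rw [hx', Pi.sub_apply, hx, ← sub_one_mul, norm_mul]
  refine mul_le_mul_of_nonneg_right ?_ (norm_nonneg _)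
  rw [← Complex.ofReal_one, ← Complex.ofReal_sub, Complex.norm_real]
  exact hC x

end Weight

/-- Near `s` the curve `f` is bounded and `C t = o(t - s)`, so `h - f` has derivative zero. -/
theorem HasDerivAt.of_norm_sub_le_mul {V : Type*} [NormedAddCommGroup V] [NormedSpace ℝ V]
    {f h : ℝ → V} {f' : V} {C : ℝ → ℝ} {s : ℝ} (hf : HasDerivAt f f' s) (hC : HasDerivAt C 0 s)
    (hC0 : C s = 0) (hh : ∀ᶠ t in nhds s, ‖h t - f t‖ ≤ C t * ‖f t‖) : HasDerivAt h f' s := by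
  have hs : h s - f s = 0 := by
    have := hh.self_of_nhds
    rw [hC0, zero_mul] at this
    exact norm_le_zero_iff.1 this
  have h0 : HasDerivAt (fun t => h t - f t) 0 s := by
    rw [hasDerivAt_iff_isLittleO] at hC ⊢
    simp only [hC0, hs, sub_zero, smul_zero] at hC ⊢
    have h1 : (fun t => C t * ‖f t‖) =o[nhds s] fun t => t - s := by
      have := hC.mul_isBigO (hf.continuousAt.norm.isBigO_one ℝ)
      simpa using this
    refine Asymptotics.IsBigO.trans_isLittleO (Asymptotics.IsBigO.of_bound 1 ?_) h1
    filter_upwards [hh] with t ht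
    rw [one_mul]
    exact ht.trans (le_abs_self _)
  have e : (fun t => h t - f t) + f = h := by
    ext t
    simp
  simpa [e] using h0.add hf

/-! ### The global trivialization is unitary. -/

section Bundle

variable {n : ℕ} {E : Type*} [NormedAddCommGroup E] [NormedSpace ℝ E] [FiniteDimensional ℝ E]
  [MeasurableSpace E]
  {K : Type*} [TopologicalSpace K] [ChartedSpace E K] [Group K] [MeasurableSpace K]
  {F : Type*} [NormedAddCommGroup F] [NormedSpace ℂ F]
  {G : Type*} [TopologicalSpace G] [ChartedSpace F G] [Group G]
  {ι : K →* G} {X : Module.Basis (Fin n) ℝ E} {μ : Measure (K × E)} {s : ℝ}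

/-- The default branch of `triv` is never taken. The equality is stated for `μ` itself, so that
fibres over different `s` can be compared almost everywhere for one measure. -/
theorem triv_ae_eq (hw : Measurable (normOmega F ι X s)) (hpos : ∀ p, 0 < normOmega F ι X s p)
    (f : Lp ℂ 2 μ) :
    triv F ι X μ s f =ᵐ[μ] fun p => f p / (√(normOmega F ι X s p) : ℂ) := by
  have h : MemLp (fun p => f p / (√(normOmega F ι X s p) : ℂ)) 2
      (μ.withDensity fun p => ENNReal.ofReal (normOmega F ι X s p)) := by
    rw [memLp_withDensity_ofReal_iff hw hpos]
    have e : (fun p => (√(normOmega F ι X s p) : ℂ) * (f p / (√(normOmega F ι X s p) : ℂ))) = f := by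
      funext p
      exact mul_div_cancel₀ _ (by exact_mod_cast (Real.sqrt_pos.2 (hpos p)).ne')
    rw [e]
    exact Lp.memLp f
  rw [triv, dif_pos h]
  have := h.coeFn_toLp
  rwa [Filter.EventuallyEq, ae_withDensity_ofReal_eq hw hpos] at this

theorem inner_triv (hw : Measurable (normOmega F ι X s)) (hpos : ∀ p, 0 < normOmega F ι X s p)
    (f g : Lp ℂ 2 μ) : inner ℂ (triv F ι X μ s f) (triv F ι X μ s g) = inner ℂ f g :=
  inner_withDensity_ofReal_eq hw hpos (triv_ae_eq hw hpos f) (triv_ae_eq hw hpos g)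

theorem triv_bijective (hw : Measurable (normOmega F ι X s)) (hpos : ∀ p, 0 < normOmega F ι X s p) :
    Function.Bijective (triv F ι X μ s) := by
  have hne : ∀ p, (√(normOmega F ι X s p) : ℂ) ≠ 0 := fun p => by
    exact_mod_cast (Real.sqrt_pos.2 (hpos p)).ne'
  constructor
  · intro f g h
    refine Lp.ext ?_
    have hf := triv_ae_eq hw hpos f
    rw [h] at hf
    filter_upwards [hf, triv_ae_eq hw hpos g] with p h1 h2
    exact (div_left_inj' (hne p)).1 (h1.symm.trans h2)
  · intro u
    have hu := (memLp_withDensity_ofReal_iff hw hpos).1 (Lp.memLp u)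
    refine ⟨hu.toLp, Lp.ext ?_⟩
    rw [Filter.EventuallyEq, ae_withDensity_ofReal_eq hw hpos]
    filter_upwards [triv_ae_eq hw hpos hu.toLp, hu.coeFn_toLp] with p h1 h2
    rw [h1, h2, mul_div_cancel_left₀ _ (hne p)]

end Bundle

/-! ### The comparison of the two connections. -/

theorem theorem2p1
    {n : ℕ}
    {E : Type*} [NormedAddCommGroup E] [NormedSpace ℝ E] [FiniteDimensional ℝ E]
    [MeasurableSpace E] [BorelSpace E]
    {K : Type*} [TopologicalSpace K] [ChartedSpace E K] [Group K] [LieGroup 𝓘(ℝ, E) ∞ K]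
    [CompactSpace K] [ConnectedSpace K] [MeasurableSpace K] [BorelSpace K]
    {F : Type*} [NormedAddCommGroup F] [NormedSpace ℂ F] [FiniteDimensional ℂ F]
    {G : Type*} [TopologicalSpace G] [ChartedSpace F G] [Group G] [LieGroup 𝓘(ℂ, F) ∞ G]
    (ι : K →* G) (hι : IsComplexification E F ι)
    (B : LinearMap.BilinForm ℝ E) (hB_symm : ∀ u v, B u v = B v u)
    (hB_pos : ∀ u, u ≠ 0 → 0 < B u u)
    (hB_Ad : ∀ (x : K) (u v : E),
      B (Ad x u) (Ad x v) = B u v)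
    (X : Module.Basis (Fin n) ℝ E) (hX : ∀ i j, B (X i) (X j) = if i = j then 1 else 0)
    (μ : Measure (K × E)) (hμ : IsLiouvilleMeasure X μ) :
    (∀ s : ℝ, 0 < s → ∀ p : K × E,
      0 < normOmega F ι X s p ∧
      bksRatio F ι X s s p = (normOmega F ι X s p : ℂ) ^ 2) ∧
    (∀ s : ℝ, 0 < s →
      Function.Bijective (triv F ι X μ s) ∧
      ∀ f g : Lp ℂ 2 μ,
        inner ℂ (triv F ι X μ s f) (triv F ι X μ s g) = inner ℂ f g) ∧
    (∀ s s' : ℝ, 0 < s → 0 < s' →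
      ∀ (τ : PrQ F ι X μ s) (σ : PrQ F ι X μ s'),
        Integrable (bksIntegrand F ι X μ τ σ) μ) ∧
    (∀ σ : (∀ s : ℝ, PrQ F ι X μ s), IsSmoothSection F ι X μ σ →
      ∀ s : ℝ, 0 < s → ∀ v : PrQ F ι X μ s,
        IsBKSCovariantDerivative F ι X μ σ s v ↔
          v = prqConnection F ι X μ σ s) := by
  obtain ⟨l, hl, hm⟩ := hι.exists_bksRatio_eq_prod B hB_symm hB_Ad X hX
  set D : ℝ → K × E → ℝ := fun r p => ∏ j, expIntegral (l p j) r / 2 with hD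
  have hDpos : ∀ r p, 0 < r → 0 < D r p := fun r p hr =>
    Finset.prod_pos fun j _ => div_pos (expIntegral_pos _ hr) two_pos
  have hratio : ∀ s s' p, bksRatio F ι X s s' p = (D (s + s') p : ℂ) := hl
  have hnorm : ∀ s, normOmega F ι X s = fun p => √(D (s + s) p) := fun s => by
    funext p
    rw [normOmega, hratio, Complex.ofReal_re]
  have hw : ∀ s, Measurable (normOmega F ι X s) := fun s => by
    rw [hnorm]
    exact (hm _).sqrt
  have hwpos : ∀ s, 0 < s → ∀ p, 0 < normOmega F ι X s p := fun s hs p => by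
    rw [hnorm]
    exact Real.sqrt_pos.2 (hDpos _ p (add_pos hs hs))
  have hbij : ∀ s, 0 < s → Function.Bijective (triv F ι X μ s) := fun s hs =>
    triv_bijective (hw s) (hwpos s hs)
  have hinner : ∀ s, 0 < s → ∀ f g : Lp ℂ 2 μ,
      inner ℂ (triv F ι X μ s f) (triv F ι X μ s g) = inner ℂ f g := fun s hs =>
    inner_triv (hw s) (hwpos s hs)
  -- The BKS pairing in the trivialization: `h` is `R f`, an `L²` function independent of `g`.
  -- Integrability and the derivative both follow from this.
  have hpair : ∀ s t, 0 < s → 0 < t → ∀ f : Lp ℂ 2 μ, ∃ h : Lp ℂ 2 μ,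
      ‖h - f‖ ≤ ((1 + (t - s) ^ 2 / (4 * s * t)) ^ n - 1) * ‖f‖ ∧ ∀ g : Lp ℂ 2 μ,
        bksIntegrand F ι X μ (triv F ι X μ s g) (triv F ι X μ t f) =ᵐ[μ]
          fun p => inner ℂ (g p) (h p) := by
    intro s t hs ht f
    let R : K × E → ℝ := fun p => √(D (s + t) p) / (√(√(D (s + s) p)) * √(√(D (t + t) p)))
    have hR : Measurable R := (hm _).sqrt.div ((hm _).sqrt.sqrt.mul (hm _).sqrt.sqrt)
    have hRC : ∀ p, |R p - 1| ≤ (1 + (t - s) ^ 2 / (4 * s * t)) ^ n - 1 := fun p => by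
      have h := one_le_bksKernel_and_le (l p) (D := fun r => D r p) (fun r => rfl) hs ht
      rw [abs_of_nonneg (sub_nonneg.2 h.1)]
      exact sub_le_sub_right h.2 1
    obtain ⟨h, hh, hle⟩ := exists_lp_eq_mul hR hRC f
    refine ⟨h, hle, fun g => ?_⟩
    filter_upwards [hh, triv_ae_eq (hw s) (hwpos s hs) g, triv_ae_eq (hw t) (hwpos t ht) f]
      with p h1 h2 h3
    -- The ratio is positive, so the principal branch is the real square root.
    have hsqrt : (bksRatio F ι X s t p) ^ (1 / 2 : ℂ) = (√(D (s + t) p) : ℂ) := by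
      rw [hratio, Real.sqrt_eq_rpow, Complex.ofReal_cpow (hDpos _ p (add_pos hs ht)).le]
      norm_num
    rw [bksIntegrand, h1, h2, h3, hsqrt, hnorm, hnorm, RCLike.inner_apply]
    simp only [R, map_div₀, Complex.conj_ofReal, Complex.ofReal_div, Complex.ofReal_mul]
    ring
  refine ⟨fun s hs p => ⟨hwpos s hs p, ?_⟩, fun s hs => ⟨hbij s hs, hinner s hs⟩,
    fun s t hs ht τ σ => ?_, fun σ hσ s hs v => ?_⟩
  · rw [hratio, hnorm, ← Complex.ofReal_pow, Real.sq_sqrt (hDpos _ p (add_pos hs hs)).le]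
  · obtain ⟨g, rfl⟩ := (hbij s hs).2 τ
    obtain ⟨f, rfl⟩ := (hbij t ht).2 σ
    obtain ⟨h, -, hint⟩ := hpair s t hs ht f
    exact (L2.integrable_inner g h).congr (hint g).symm
  · have hder : HasDerivAt (inTriv F ι X μ σ) (deriv (inTriv F ι X μ σ) s) s :=
      ((hσ.differentiableOn (by simp)).differentiableAt (Ioi_mem_nhds hs)).hasDerivAt
    have hσt : ∀ t, 0 < t → triv F ι X μ t (inTriv F ι X μ σ t) = σ t := fun t ht =>
      Function.invFun_eq ((hbij t ht).2 (σ t))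
    have hex : ∀ t, ∃ h : Lp ℂ 2 μ, 0 < t →
        ‖h - inTriv F ι X μ σ t‖ ≤ ((1 + (t - s) ^ 2 / (4 * s * t)) ^ n - 1) * ‖inTriv F ι X μ σ t‖ ∧
        ∀ g : Lp ℂ 2 μ, bksPairing F ι X μ (triv F ι X μ s g) (σ t) = inner ℂ g h := fun t => by
      by_cases ht : 0 < t
      · obtain ⟨h, hle, hint⟩ := hpair s t hs ht (inTriv F ι X μ σ t)
        refine ⟨h, fun _ => ⟨hle, fun g => ?_⟩⟩
        rw [bksPairing, ← hσt t ht, integral_congr_ae (hint g), L2.inner_def]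
      -- For `t ≤ 0` any value will do, since only `t` near `s > 0` enters the derivative.
      · exact ⟨0, fun h => absurd h ht⟩
    choose h hh using hex
    -- The first-order term is absent because `(t - s)²` has a double zero at `s`.
    have hC : HasDerivAt (fun t => (1 + (t - s) ^ 2 / (4 * s * t)) ^ n - 1) 0 s := by
      have h1 : HasDerivAt (fun t : ℝ => (t - s) ^ 2 / (4 * s * t)) 0 s := by
        have h2 := (((hasDerivAt_id s).sub_const s).fun_pow 2).fun_div ((hasDerivAt_id s).const_mul (4 * s))
          (by simp [hs.ne'])
        simpa using h2
      simpa using ((h1.const_add 1).pow n).sub_const 1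
    have hh' : HasDerivAt h (deriv (inTriv F ι X μ σ) s) s := by
      refine hder.of_norm_sub_le_mul hC (by simp) ?_
      filter_upwards [Ioi_mem_nhds hs] with t ht using (hh t ht).1
    have hbks : IsBKSCovariantDerivative F ι X μ σ s (prqConnection F ι X μ σ s) := fun τ => by
      obtain ⟨g, rfl⟩ := (hbij s hs).2 τ
      rw [prqConnection, hinner s hs]
      have h1 : HasDerivAt (fun t => inner ℂ g (h t)) (inner ℂ g (deriv (inTriv F ι X μ σ) s)) s := by
        simpa using (hasDerivAt_const s g).inner ℂ hh'
      refine h1.congr_of_eventuallyEq ?_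
      filter_upwards [Ioi_mem_nhds hs] with t ht using (hh t ht).2 g
    constructor
    · intro hv
      -- Derivatives are unique, so both vectors have the same inner product with every `τ`.
      exact ext_inner_left ℂ fun τ => (hv τ).unique (hbks τ)
    · rintro rfl
      exact hbks
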